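/- All Hilbert spaces are finite-dimensional. For a density operator (positive semidefinite, unit trace) $\rho$ and a positive semidefinite operator $\sigma$, let $D(\rho\Vert\sigma)=\operatorname{Tr}\{\rho[\log\rho-\log\sigma]\}$ if $\operatorname{supp}(\rho)\subseteq\operatorname{supp}(\sigma)$ and $D(\rho\Vert\sigma)=+\infty$ otherwise (natural logarithm, taken on the support). For positive semidefinite operators let $F(\tau,\varsigma)=\Vert\sqrt{\tau}\sqrt{\varsigma}\Vert_1^2$ be the fidelity and $D_B^2(\tau,\varsigma)=2(1-\sqrt{F(\tau,\varsigma)})$ the squared Bures distance. Subscripts denote partial traces, e.g. $\rho_B=\operatorname{Tr}_A\rho_{AB}$, and identity tensor factors are suppressed in operator products. Let $H(A|B)_\rho=-D(\rho_{AB}\Vert I_A\otimes\rho_B)$ and $I(A;B|C)_\omega=D(\omega_{ABC}\Vert\omega_{AC}\otimes I_B)-D(\omega_{BC}\Vert\omega_C\otimes I_B)$. **Theorem.** The following five statements are equivalent (it is not claimed that any of them is true). 1. (Strong subadditivity) For all finite-dimensional systems $A,B,C$ and every density operator $\omega_{ABC}$ such that $\omega_C$ is positive definite, $$I(A;B|C)_\omega\ge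 D_B^2\bigl(\omega_{ABC},\ \omega_{AC}^{1/2}\omega_C^{-1/2}\,\omega_{BC}\,\omega_C^{-1/2}\omega_{AC}^{1/2}\bigr).$$ 2. (Concavity of conditional entropy) For all finite-dimensional systems $A,B$, every probability distribution $p$ on a finite set $X$ and all density operators $\rho^x_{AB}$ ($x\in X$) such that, with $\overline\rho_{AB}=\sum_x p(x)\rho^x_{AB}$, the operator $\overline\rho_B$ is positive definite, $$H(A|B)_{\overline\rho}-\sum_x p(x)H(A|B)_{\rho^x}\ge\sum_x p(x)\,D_B^2\bigl(\rho^x_{AB},\ \overline\rho_{AB}^{1/2}\overline\rho_B^{-1/2}\rho^x_B\,\overline\rho_B^{-1/2}\overline\rho_{AB}^{1/2}\bigr).$$ 3. (Monotonicity of relative entropy under partial trace) For all finite-dimensional systems $A,B$ and all density operators $\rho_{AB},\sigma_{AB}$ such that $\operatorname{supp}(\rho_{AB})\subseteq\operatorname{supp}(\sigma_{AB})$ and $\sigma_B$ is positive definite, $$D(\rho_{AB}\Vert\sigma_{AB})-D(\rho_B\Vert\sigma_B)\ge D_B^2\bigl(\rho_{AB},\ \sigma_{AB}^{1/2}\sigma_B^{-1/2}\rho_B\,\sigma_B^{-1/2}\sigma_{AB}^{1/2}\bigr).$$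 4. (Joint convexity of relative entropy) For every finite-dimensional system, every probability distribution $p$ on a finite set $X$ and all density operators $\rho_x,\sigma_x$ ($x\in X$) with $\operatorname{supp}(\rho_x)\subseteq\operatorname{supp}(\sigma_x)$ such that, with $\overline\rho=\sum_x p(x)\rho_x$ and $\overline\sigma=\sum_x p(x)\sigma_x$, the operator $\overline\sigma$ is positive definite, $$\sum_x p(x)D(\rho_x\Vert\sigma_x)-D(\overline\rho\Vert\overline\sigma)\ge\sum_x p(x)\,D_B^2\bigl(\rho_x,\ \sigma_x^{1/2}\,\overline\sigma^{-1/2}\,\overline\rho\,\overline\sigma^{-1/2}\sigma_x^{1/2}\bigr).$$ 5. (Monotonicity of relative entropy under channels) For all finite-dimensional systems $S,B$, all density operators $\rho,\sigma$ on $S$ with $\operatorname{supp}(\rho)\subseteq\operatorname{supp}(\sigma)$ and every completely positive trace preserving map $\mathcal N$ from operators on $S$ to operators on $B$ such that $\mathcal N(\sigma)$ is positive definite, $$D(\rho\Vert\sigma)-D(\mathcal N(\rho)\Vert\mathcal N(\sigma))\ge D_B^2\Bigl(\rho,\ \sigma^{1/2}\mathcal N^\dagger\bigl(\mathcal N(\sigma)^{-1/2}\,\mathcal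 N(\rho)\,\mathcal N(\sigma)^{-1/2}\bigr)\sigma^{1/2}\Bigr),$$ where $\mathcal N^\dagger$ is the adjoint of $\mathcal N$ for the Hilbert--Schmidt inner product $\langle X,Y\rangle=\operatorname{Tr}\{X^\dagger Y\}$. -/

import Mathlib

open scoped Kronecker Matrix ComplexOrder

universe u

namespace PetzRemainder

noncomputable section

/-! Operators on a finite-dimensional Hilbert space are complex matrices indexed by a finite type
(an orthonormal basis); the tensor product of two spaces is indexed by the product type. -/

/-- A density operator: positive semidefinite with unit trace. -/
def IsDensity {n : Type u} [Fintype n] (ρ : Matrix n n ℂ) : Prop :=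
  ρ.PosSemidef ∧ ρ.trace = 1

/-- The support of a positive semidefinite operator, that is, its range (equivalently, the
orthogonal complement of its kernel). -/
def supp {n : Type u} [Fintype n] (M : Matrix n n ℂ) : Submodule ℂ (n → ℂ) :=
  LinearMap.range M.mulVecLin

/-- The square root `M ^ (1/2)` of a positive semidefinite operator. -/
def msqrt {n : Type u} [Fintype n] [DecidableEq n] (M : Matrix n n ℂ) : Matrix n n ℂ :=
  cfc Real.sqrt M

/-- The inverse square root `M ^ (-1/2)` of a positive definite operator. -/
def minvsqrt {n : Type u} [Fintype n] [DecidableEq n] (M : Matrix n n ℂ) : Matrix n n ℂ :=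
  cfc (fun x : ℝ => (Real.sqrt x)⁻¹) M

/-- The logarithm of a positive semidefinite operator, taken on its support (and zero on its
kernel, as `Real.log 0 = 0`). -/
def mlog {n : Type u} [Fintype n] [DecidableEq n] (M : Matrix n n ℂ) : Matrix n n ℂ :=
  cfc Real.log M

open Classical in
/-- The Umegaki relative entropy `D(ρ‖σ)`: it is `Tr {ρ (log ρ - log σ)}` if
`supp ρ ⊆ supp σ`, and `+∞` otherwise. -/
def relEntropy {n : Type u} [Fintype n] [DecidableEq n] (ρ σ : Matrix n n ℂ) : EReal :=
  if supp ρ ≤ supp σ then (((ρ * (mlog ρ - mlog σ)).trace.re : ℝ) : EReal) else ⊤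

/-- The trace norm `‖M‖₁ = Tr {(M† M) ^ (1/2)}`. -/
def traceNorm {n : Type u} [Fintype n] [DecidableEq n] (M : Matrix n n ℂ) : ℝ :=
  (msqrt (Mᴴ * M)).trace.re

/-- The quantum fidelity `F(τ, ς) = ‖√τ √ς‖₁ ^ 2` of positive semidefinite operators. -/
def fidelity {n : Type u} [Fintype n] [DecidableEq n] (τ ς : Matrix n n ℂ) : ℝ :=
  traceNorm (msqrt τ * msqrt ς) ^ 2

/-- The square of the Bures distance, `2 (1 - √F)`. -/
def buresSq {n : Type u} [Fintype n] [DecidableEq n] (τ ς : Matrix n n ℂ) : ℝ :=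
  2 * (1 - Real.sqrt (fidelity τ ς))

/-- The partial trace over the left tensor factor, `M_{AB} ↦ M_B = Tr_A M_{AB}`. -/
def trLeft {A B : Type u} [Fintype A] (M : Matrix (A × B) (A × B) ℂ) : Matrix B B ℂ :=
  Matrix.of fun b b' => ∑ a, M (a, b) (a, b')

/-- The partial trace over the middle tensor factor, `M_{ABC} ↦ M_{AC} = Tr_B M_{ABC}`. -/
def trMiddle {A B C : Type u} [Fintype B] (M : Matrix (A × B × C) (A × B × C) ℂ) :
    Matrix (A × C) (A × C) ℂ :=
  Matrix.of fun x y => ∑ b, M (x.1, b, x.2) (y.1, b, y.2)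

/-- The operator `M_{AC} ⊗ I_B` on `A ⊗ B ⊗ C`, for `M_{AC}` acting on `A ⊗ C`. -/
def tensorIdMiddle {A C : Type u} (B : Type u) [DecidableEq B]
    (M : Matrix (A × C) (A × C) ℂ) : Matrix (A × B × C) (A × B × C) ℂ :=
  Matrix.of fun x y => M (x.1, x.2.2) (y.1, y.2.2) * (1 : Matrix B B ℂ) x.2.1 y.2.1

/-- The conditional mutual information
`I(A;B|C) = D(ω_{ABC} ‖ ω_{AC} ⊗ I_B) - D(ω_{BC} ‖ ω_C ⊗ I_B)`. -/
def condMutualInfo {A B C : Type u} [Fintype A] [DecidableEq A] [Fintype B] [DecidableEq B]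
    [Fintype C] [DecidableEq C] (ω : Matrix (A × B × C) (A × B × C) ℂ) : EReal :=
  relEntropy ω (tensorIdMiddle B (trMiddle ω)) -
    relEntropy (trLeft ω) ((1 : Matrix B B ℂ) ⊗ₖ trLeft (trLeft ω))

/-- The conditional entropy `H(A|B) = -D(σ_{AB} ‖ I_A ⊗ σ_B)`. -/
def condEntropy {A B : Type u} [Fintype A] [DecidableEq A] [Fintype B] [DecidableEq B]
    (σ : Matrix (A × B) (A × B) ℂ) : EReal :=
  -relEntropy σ ((1 : Matrix A A ℂ) ⊗ₖ trLeft σ)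

/-- The operator `ω_{AC}^{1/2} ω_C^{-1/2} Y_{BC} ω_C^{-1/2} ω_{AC}^{1/2}` on `A ⊗ B ⊗ C`: the
Petz recovery map `C → AC` of `ω`, applied to the `C` system of an operator `Y` on `B ⊗ C`. -/
def petzCtoAC {A B C : Type u} [Fintype A] [DecidableEq A] [Fintype B] [DecidableEq B]
    [Fintype C] [DecidableEq C] (ω : Matrix (A × B × C) (A × B × C) ℂ)
    (Y : Matrix (B × C) (B × C) ℂ) : Matrix (A × B × C) (A × B × C) ℂ :=
  let ωAC := trMiddle ω
  let ωC := trLeft (trLeft ω)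
  let K := (1 : Matrix B B ℂ) ⊗ₖ minvsqrt ωC
  tensorIdMiddle B (msqrt ωAC) * ((1 : Matrix A A ℂ) ⊗ₖ (K * Y * K)) *
    tensorIdMiddle B (msqrt ωAC)

/-- The Petz recovery map of `σ_{AB}` and `Tr_A`:
`Y_B ↦ σ_{AB}^{1/2} σ_B^{-1/2} Y_B σ_B^{-1/2} σ_{AB}^{1/2}`. -/
def petzPartialTrace {A B : Type u} [Fintype A] [DecidableEq A] [Fintype B] [DecidableEq B]
    (σ : Matrix (A × B) (A × B) ℂ) (Y : Matrix B B ℂ) : Matrix (A × B) (A × B) ℂ :=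
  msqrt σ * ((1 : Matrix A A ℂ) ⊗ₖ (minvsqrt (trLeft σ) * Y * minvsqrt (trLeft σ))) * msqrt σ

/-- The ampliation `id_k ⊗ N`, applied to an operator `M` on `ℂ^k ⊗ S`. -/
def ampliate {S B : Type u} (N : Matrix S S ℂ →ₗ[ℂ] Matrix B B ℂ) (k : ℕ)
    (M : Matrix (Fin k × S) (Fin k × S) ℂ) : Matrix (Fin k × B) (Fin k × B) ℂ :=
  Matrix.of fun x y => N (Matrix.of fun s s' => M (x.1, s) (y.1, s')) x.2 y.2

/-- A quantum channel: a completely positive and trace preserving linear map. -/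
structure IsCPTP {S B : Type u} [Fintype S] [Fintype B]
    (N : Matrix S S ℂ →ₗ[ℂ] Matrix B B ℂ) : Prop where
  completelyPositive : ∀ (k : ℕ) (M : Matrix (Fin k × S) (Fin k × S) ℂ),
    M.PosSemidef → (ampliate N k M).PosSemidef
  tracePreserving : ∀ M : Matrix S S ℂ, (N M).trace = M.trace

/-- The adjoint `N†` of `N` for the Hilbert-Schmidt inner product `⟨X, Y⟩ = Tr {X† Y}`; its
`(i, j)` entry is `⟨E_ij, N† Y⟩ = ⟨N E_ij, Y⟩` for the matrix unit `E_ij`. -/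
def hsAdjoint {S B : Type u} [DecidableEq S] [Fintype B]
    (N : Matrix S S ℂ →ₗ[ℂ] Matrix B B ℂ) (Y : Matrix B B ℂ) : Matrix S S ℂ :=
  Matrix.of fun i j => ((N (Matrix.single i j 1))ᴴ * Y).trace

/-- The defining property of the adjoint: `⟨X, N† Y⟩ = ⟨N X, Y⟩`. -/
theorem trace_mul_hsAdjoint {S B : Type u} [Fintype S] [DecidableEq S] [Fintype B]
    (N : Matrix S S ℂ →ₗ[ℂ] Matrix B B ℂ) (X : Matrix S S ℂ) (Y : Matrix B B ℂ) :
    (Xᴴ * hsAdjoint N Y).trace = ((N X)ᴴ * Y).trace := by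
  have hX : N X = ∑ i, ∑ j, X i j • N (Matrix.single i j 1) := by
    conv_lhs => rw [Matrix.matrix_eq_sum_single X]
    simp only [map_sum]
    refine Finset.sum_congr rfl fun i _ => Finset.sum_congr rfl fun j _ => ?_
    rw [← map_smul, Matrix.smul_single, smul_eq_mul, mul_one]
  rw [hX]
  simp only [Matrix.conjTranspose_sum, Matrix.conjTranspose_smul, Finset.sum_mul,
    Matrix.trace_sum, Matrix.smul_mul, Matrix.trace_smul, smul_eq_mul]
  rw [Finset.sum_comm, Matrix.trace]
  simp only [Matrix.diag_apply, Matrix.mul_apply, Matrix.conjTranspose_apply]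
  rfl

/-- The Petz recovery map of `σ` and `N`:
`Y ↦ σ^{1/2} N†(N(σ)^{-1/2} Y N(σ)^{-1/2}) σ^{1/2}`. -/
def petz {S B : Type u} [Fintype S] [DecidableEq S] [Fintype B] [DecidableEq B]
    (σ : Matrix S S ℂ) (N : Matrix S S ℂ →ₗ[ℂ] Matrix B B ℂ) (Y : Matrix B B ℂ) :
    Matrix S S ℂ :=
  msqrt σ * hsAdjoint N (minvsqrt (N σ) * Y * minvsqrt (N σ)) * msqrt σ

/-- A probability distribution on a finite alphabet. -/
def IsProb {X : Type u} [Fintype X] (p : X → ℝ) : Prop :=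
  (∀ x, 0 ≤ p x) ∧ ∑ x, p x = 1

/-- Strong subadditivity with Petz remainder term, on all finite-dimensional systems. -/
def StrongSubadditivity : Prop :=
  ∀ (A B C : Type u) [Fintype A] [DecidableEq A] [Fintype B] [DecidableEq B]
    [Fintype C] [DecidableEq C] (ω : Matrix (A × B × C) (A × B × C) ℂ),
    IsDensity ω → (trLeft (trLeft ω)).PosDef →
      ((buresSq ω (petzCtoAC ω (trLeft ω)) : ℝ) : EReal) ≤ condMutualInfo ω

/-- Concavity of conditional entropy with Petz remainder term. -/
def ConcavityCondEntropy : Prop :=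
  ∀ (X A B : Type u) [Fintype X] [Fintype A] [DecidableEq A] [Fintype B] [DecidableEq B]
    (p : X → ℝ) (ρ : X → Matrix (A × B) (A × B) ℂ),
    IsProb p → (∀ x, IsDensity (ρ x)) → (trLeft (∑ y, p y • ρ y)).PosDef →
      ((∑ x, p x * buresSq (ρ x) (petzPartialTrace (∑ y, p y • ρ y) (trLeft (ρ x))) : ℝ) : EReal)
        ≤ condEntropy (∑ y, p y • ρ y) - ∑ x, (p x : EReal) * condEntropy (ρ x)

/-- Monotonicity of relative entropy under partial trace, with Petz remainder term. -/
def MonotonicityPartialTrace : Prop :=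
  ∀ (A B : Type u) [Fintype A] [DecidableEq A] [Fintype B] [DecidableEq B]
    (ρ σ : Matrix (A × B) (A × B) ℂ),
    IsDensity ρ → IsDensity σ → supp ρ ≤ supp σ → (trLeft σ).PosDef →
      ((buresSq ρ (petzPartialTrace σ (trLeft ρ)) : ℝ) : EReal)
        ≤ relEntropy ρ σ - relEntropy (trLeft ρ) (trLeft σ)

/-- Joint convexity of relative entropy with Petz remainder term. -/
def JointConvexity : Prop :=
  ∀ (X S : Type u) [Fintype X] [Fintype S] [DecidableEq S]
    (p : X → ℝ) (ρ σ : X → Matrix S S ℂ),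
    IsProb p → (∀ x, IsDensity (ρ x)) → (∀ x, IsDensity (σ x)) →
    (∀ x, supp (ρ x) ≤ supp (σ x)) → (∑ y, p y • σ y).PosDef →
      ((∑ x, p x * buresSq (ρ x)
          (msqrt (σ x) * minvsqrt (∑ y, p y • σ y) * (∑ y, p y • ρ y) *
            minvsqrt (∑ y, p y • σ y) * msqrt (σ x)) : ℝ) : EReal)
        ≤ (∑ x, (p x : EReal) * relEntropy (ρ x) (σ x)) -
          relEntropy (∑ y, p y • ρ y) (∑ y, p y • σ y)

/-- Monotonicity of relative entropy under quantum channels, with Petz remainder term. -/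
def MonotonicityChannel : Prop :=
  ∀ (S B : Type u) [Fintype S] [DecidableEq S] [Fintype B] [DecidableEq B]
    (ρ σ : Matrix S S ℂ) (N : Matrix S S ℂ →ₗ[ℂ] Matrix B B ℂ),
    IsDensity ρ → IsDensity σ → supp ρ ≤ supp σ → IsCPTP N → (N σ).PosDef →
      ((buresSq ρ (petz σ N (N ρ)) : ℝ) : EReal)
        ≤ relEntropy ρ σ - relEntropy (N ρ) (N σ)

end

end PetzRemainder

set_option linter.unusedSectionVars false

namespace PetzRemainder

noncomputable section

/-! ### Functional calculus of Hermitian matrices through polynomials -/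

section FunctionalCalculus

variable {n m : Type*} [Fintype n] [DecidableEq n] [Fintype m] [DecidableEq m]

/-! Monotonicity under partial trace is the hub. Except for one analytic step, every implication is
a choice of operators for which both sides of the two inequalities agree exactly. The remainder
survives these reductions because relative entropy, Bures distance and Petz map behave well under
isometries, direct sums and scalars.

Strong subadditivity is the case σ = ω_AC ⊗ I_B/|B|. Joint convexity is the case of direct sums ⊕
p(x)ρ_x and ⊕ p(x)σ_x whose classical register is traced out. Conversely, averaging over signed
permutations of A sends M to I_A/|A| ⊗ M_B (`card_smul_sum_twirl`), so joint convexity of the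
twirled pair gives the partial trace back. Channels reduce to the partial trace by Stinespring
(`IsCPTP.exists_dilation`), and the partial trace is itself a channel. Concavity is strong
subadditivity of ω = ⊕ p(x)ρ^x, with the classical register as B.

The analytic step leads from concavity back to the hub. The concavity gap equals ∑ p(x) [D(ρ^x‖ρ̄) -
D(ρ^x_B‖ρ̄_B)] (`condEntropy_sub_sum_condEntropy`). Give ρ weight t and σ weight 1 - t, divide by t
and let t → 0+. Of the σ terms, the Bures term and D(σ_B‖ρ̄_B) are nonnegative and can be dropped,
while D(σ‖(1-t)σ + tρ) is o(t) (`exists_umegaki_mix_le`). The ρ terms converge to the desired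
inequality. Since σ may be singular, logarithms are controlled by adding the projection onto its
kernel. -/

theorem exists_polynomial_eval_eq {s : Set ℝ} (hs : s.Finite) (f : ℝ → ℝ) :
    ∃ q : Polynomial ℝ, ∀ t ∈ s, q.eval t = f t := by
  classical
  refine ⟨Lagrange.interpolate hs.toFinset id f, fun t ht => ?_⟩
  have := Lagrange.eval_interpolate_at_node (v := (id : ℝ → ℝ)) f
    (s := hs.toFinset) (Function.injective_id.injOn) (hs.mem_toFinset.2 ht)
  simpa using this

theorem continuousOn_spectrum (M : Matrix n n ℂ) (f : ℝ → ℝ) : ContinuousOn f (spectrum ℝ M) :=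
  M.finite_real_spectrum.continuousOn f

theorem isHermitian_cfc (f : ℝ → ℝ) (M : Matrix n n ℂ) : (cfc f M).IsHermitian :=
  cfc_predicate (p := IsSelfAdjoint) f M

/-- Interpolating on a union of finite spectra yields one polynomial valid for several matrices at
once, so identities stable under polynomials pass to arbitrary `f`, with no continuity required. -/
theorem cfc_eq_aeval {M : Matrix n n ℂ} (hM : M.IsHermitian) {f : ℝ → ℝ} {q : Polynomial ℝ}
    (h : ∀ t ∈ spectrum ℝ M, q.eval t = f t) : cfc f M = Polynomial.aeval M q := by
  rw [← cfc_polynomial q M hM.isSelfAdjoint]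
  exact cfc_congr fun t ht => (h t ht).symm

theorem cfc_mul_cfc (f g : ℝ → ℝ) (M : Matrix n n ℂ) :
    cfc f M * cfc g M = cfc (fun t => f t * g t) M :=
  (cfc_mul f g M (continuousOn_spectrum M f) (continuousOn_spectrum M g)).symm

theorem mul_cfc {M : Matrix n n ℂ} (hM : M.IsHermitian) (f : ℝ → ℝ) :
    M * cfc f M = cfc (fun t => t * f t) M := by
  conv_lhs => rw [← cfc_id ℝ M hM.isSelfAdjoint]
  rw [cfc_id ℝ M hM.isSelfAdjoint]
  nth_rw 1 [← cfc_id ℝ M hM.isSelfAdjoint]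
  exact cfc_mul_cfc _ _ _

theorem cfc_smul_arg (c : ℝ) (f : ℝ → ℝ) {M : Matrix n n ℂ} (hM : M.IsHermitian) :
    cfc f (c • M) = cfc (fun t => f (c * t)) M := by
  have := (cfc_comp_smul c f M (by
    exact (M.finite_real_spectrum.image _).continuousOn _) hM.isSelfAdjoint)
  simpa using this.symm

theorem aeval_conj_isometry {V : Matrix m n ℂ} (hV : Vᴴ * V = 1) (M : Matrix n n ℂ)
    {q : Polynomial ℝ} (hq : q.eval 0 = 0) :
    Polynomial.aeval (V * M * Vᴴ) q = V * Polynomial.aeval M q * Vᴴ := by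
  have hpow : ∀ k : ℕ, (V * M * Vᴴ) ^ (k + 1) = V * M ^ (k + 1) * Vᴴ := by
    intro k
    induction k with
    | zero => simp
    | succ k ih =>
      rw [pow_succ, ih, pow_succ M (k + 1)]
      calc V * M ^ (k + 1) * Vᴴ * (V * M * Vᴴ)
          = V * M ^ (k + 1) * (Vᴴ * V) * M * Vᴴ := by simp only [Matrix.mul_assoc]
        _ = _ := by rw [hV, Matrix.mul_one]; simp only [Matrix.mul_assoc]
  rw [Polynomial.aeval_eq_sum_range, Polynomial.aeval_eq_sum_range, Matrix.mul_sum,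
    Matrix.sum_mul]
  refine Finset.sum_congr rfl fun k _ => ?_
  cases k with
  | zero => simp [Polynomial.coeff_zero_eq_eval_zero, hq]
  | succ k => rw [hpow]; simp

/-- `V * M * Vᴴ` is `M` on the range of `V` and zero on its complement, so `f 0 = 0` is needed. The
square root satisfies it, and the logarithm does by the convention `Real.log 0 = 0`. -/
theorem cfc_conj_isometry {V : Matrix m n ℂ} (hV : Vᴴ * V = 1) {M : Matrix n n ℂ}
    (hM : M.IsHermitian) {f : ℝ → ℝ} (hf : f 0 = 0) :
    cfc f (V * M * Vᴴ) = V * cfc f M * Vᴴ := by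
  -- The node 0 is adjoined because it need not be an eigenvalue of either operator.
  obtain ⟨q, hq⟩ := exists_polynomial_eval_eq ((M.finite_real_spectrum.union
    (V * M * Vᴴ).finite_real_spectrum).union (Set.finite_singleton 0)) f
  rw [cfc_eq_aeval (Matrix.isHermitian_mul_mul_conjTranspose V hM) (q := q) (fun t ht => hq t (by simp [ht])),
    cfc_eq_aeval hM (q := q) (fun t ht => hq t (by simp [ht])),
    aeval_conj_isometry hV M ((hq 0 (by simp)).trans hf)]

/-- Adding a projection orthogonal to `M` does not change `f M` if `f 0 = f 1 = 0`. -/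
theorem cfc_add_orthogonal_projection {M P : Matrix n n ℂ} (hM : M.IsHermitian)
    (hP : P.IsHermitian) (hPP : P * P = P) (hMP : M * P = 0) {f : ℝ → ℝ}
    (h0 : f 0 = 0) (h1 : f 1 = 0) : cfc f (M + P) = cfc f M := by
  have hPM : P * M = 0 := by
    have := congrArg Matrix.conjTranspose hMP
    simpa [Matrix.conjTranspose_mul, hM.eq, hP.eq] using this
  obtain ⟨q, hq⟩ := exists_polynomial_eval_eq ((M.finite_real_spectrum.union
    (M + P).finite_real_spectrum).union (Set.toFinite {0, 1})) f
  rw [cfc_eq_aeval (hM.add hP) (q := q) (fun t ht => hq t (by simp [ht])),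
    cfc_eq_aeval hM (q := q) (fun t ht => hq t (by simp [ht]))]
  have hp : ∀ k : ℕ, (M + P) ^ (k + 1) = M ^ (k + 1) + P := by
    intro k
    induction k with
    | zero => simp
    | succ k ih =>
      rw [pow_succ, ih, Matrix.mul_add, Matrix.add_mul, Matrix.add_mul, hPM, hPP,
        pow_succ M (k + 1), pow_succ M k, Matrix.mul_assoc _ M P, hMP]
      simp
  have hq0 : q.coeff 0 = 0 := by
    rw [Polynomial.coeff_zero_eq_eval_zero, hq 0 (by simp), h0]
  -- The coefficients sum to `q(1) = f 1 = 0`, so the copies of `P` produced by the powers cancel.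
  have hq1 : ∑ i ∈ Finset.range (q.natDegree + 1), q.coeff i = 0 := by
    have := hq 1 (by simp)
    rw [h1, Polynomial.eval_eq_sum_range] at this
    simpa using this
  have : ∀ i ∈ Finset.range (q.natDegree + 1),
      q.coeff i • (M + P) ^ i = q.coeff i • M ^ i + q.coeff i • P := by
    intro i _
    cases i with
    | zero => simp [hq0]
    | succ k => rw [hp, smul_add]
  rw [Polynomial.aeval_eq_sum_range, Polynomial.aeval_eq_sum_range, Finset.sum_congr rfl this,
    Finset.sum_add_distrib, ← Finset.sum_smul, hq1, zero_smul, add_zero]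

open scoped MatrixOrder in
theorem posSemidef_cfc {f : ℝ → ℝ} {M : Matrix n n ℂ} (h : ∀ t ∈ spectrum ℝ M, 0 ≤ f t) :
    (cfc f M).PosSemidef :=
  Matrix.nonneg_iff_posSemidef.1 (cfc_nonneg h)

theorem spectrum_nonneg_of_posSemidef {M : Matrix n n ℂ} (hM : M.PosSemidef) {t : ℝ}
    (ht : t ∈ spectrum ℝ M) : 0 ≤ t := by
  rw [hM.1.spectrum_real_eq_range_eigenvalues] at ht
  obtain ⟨i, rfl⟩ := ht
  exact hM.eigenvalues_nonneg i

theorem spectrum_pos_of_posDef {M : Matrix n n ℂ} (hM : M.PosDef) {t : ℝ}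
    (ht : t ∈ spectrum ℝ M) : 0 < t := by
  rw [hM.1.spectrum_real_eq_range_eigenvalues] at ht
  obtain ⟨i, rfl⟩ := ht
  exact hM.eigenvalues_pos i

end FunctionalCalculus

/-! ### Square roots, inverse square roots and logarithms -/

section SquareRoots

variable {n m : Type u} [Fintype n] [DecidableEq n] [Fintype m] [DecidableEq m]

theorem isHermitian_msqrt (M : Matrix n n ℂ) : (msqrt M).IsHermitian := isHermitian_cfc _ _

theorem isHermitian_minvsqrt (M : Matrix n n ℂ) : (minvsqrt M).IsHermitian := isHermitian_cfc _ _

theorem posSemidef_msqrt (M : Matrix n n ℂ) : (msqrt M).PosSemidef :=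
  posSemidef_cfc fun t _ => Real.sqrt_nonneg t

theorem msqrt_mul_self {M : Matrix n n ℂ} (hM : M.PosSemidef) : msqrt M * msqrt M = M := by
  rw [msqrt, cfc_mul_cfc]
  nth_rw 2 [← cfc_id ℝ M hM.1.isSelfAdjoint]
  exact cfc_congr fun t ht => Real.mul_self_sqrt (spectrum_nonneg_of_posSemidef hM ht)

theorem msqrt_smul {c : ℝ} (hc : 0 ≤ c) {M : Matrix n n ℂ} (hM : M.IsHermitian) :
    msqrt (c • M) = Real.sqrt c • msqrt M := by
  rw [msqrt, cfc_smul_arg c _ hM, msqrt, ← cfc_const_mul _ _ _ (continuousOn_spectrum M _)]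
  exact cfc_congr fun t _ => Real.sqrt_mul hc t

theorem minvsqrt_smul {c : ℝ} (hc : 0 ≤ c) {M : Matrix n n ℂ} (hM : M.IsHermitian) :
    minvsqrt (c • M) = (Real.sqrt c)⁻¹ • minvsqrt M := by
  rw [minvsqrt, cfc_smul_arg c _ hM, minvsqrt, ← cfc_const_mul _ _ _ (continuousOn_spectrum M _)]
  exact cfc_congr fun t _ => by simp only [Real.sqrt_mul hc t, mul_inv]

/-- The factor `M` removes the kernel, where log(cM) = log c + log M fails because both logarithms
are zero there. -/
theorem mul_mlog_smul {c : ℝ} (hc : c ≠ 0) {M : Matrix n n ℂ} (hM : M.IsHermitian) :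
    M * mlog (c • M) = Real.log c • M + M * mlog M := by
  have hid : Real.log c • M = cfc (fun t => Real.log c * id t) M := by
    rw [cfc_const_mul _ _ _ (continuousOn_spectrum M _), cfc_id ℝ M hM.isSelfAdjoint]
  rw [mlog, cfc_smul_arg c _ hM, mlog, mul_cfc hM, mul_cfc hM, hid,
    ← cfc_add _ _ _ (continuousOn_spectrum M _) (continuousOn_spectrum M _)]
  refine cfc_congr fun t _ => ?_
  rcases eq_or_ne t 0 with rfl | ht
  · simp
  · simp only [Real.log_mul hc ht, id]; ring

theorem minvsqrt_mul_mul_minvsqrt {M : Matrix n n ℂ} (hM : M.PosDef) :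
    minvsqrt M * M * minvsqrt M = 1 := by
  rw [Matrix.mul_assoc, minvsqrt, mul_cfc hM.1, cfc_mul_cfc, ← cfc_const_one ℝ M hM.1.isSelfAdjoint]
  refine cfc_congr fun t ht => ?_
  have h := spectrum_pos_of_posDef hM ht
  have h2 := Real.mul_self_sqrt h.le
  have h3 := (Real.sqrt_pos.2 h).ne'
  field_simp
  nlinarith

theorem msqrt_conj {V : Matrix m n ℂ} (hV : Vᴴ * V = 1) {M : Matrix n n ℂ}
    (hM : M.IsHermitian) : msqrt (V * M * Vᴴ) = V * msqrt M * Vᴴ :=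
  cfc_conj_isometry hV hM Real.sqrt_zero

theorem mlog_conj {V : Matrix m n ℂ} (hV : Vᴴ * V = 1) {M : Matrix n n ℂ}
    (hM : M.IsHermitian) : mlog (V * M * Vᴴ) = V * mlog M * Vᴴ :=
  cfc_conj_isometry hV hM Real.log_zero

end SquareRoots

/-! ### Inclusion of supports -/

section Support

variable {n m : Type u} [Fintype n] [DecidableEq n] [Fintype m] [DecidableEq m]

/-- Factorization makes inclusion of supports algebraic: it then passes through scalars, isometries
and blocks by multiplication. -/
theorem supp_le_supp_iff {ρ σ : Matrix n n ℂ} : supp ρ ≤ supp σ ↔ ∃ X, ρ = σ * X := by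
  constructor
  · intro h
    have : ∀ j, ∃ v, σ *ᵥ v = ρ *ᵥ Pi.single j 1 := fun j => by
      have := h (LinearMap.mem_range_self ρ.mulVecLin (Pi.single j 1))
      simpa [supp] using this
    choose v hv using this
    refine ⟨Matrix.of fun i j => v j i, ?_⟩
    ext i j
    have := congrFun (hv j) i
    simp only [Matrix.mulVec_single_one, Matrix.col_apply] at this
    rw [← this]
    rfl
  · rintro ⟨X, rfl⟩ w ⟨v, rfl⟩
    exact ⟨X *ᵥ v, by simp⟩

theorem exists_eq_mul_right_of_supp_le {ρ σ : Matrix n n ℂ} (hρ : ρ.IsHermitian)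
    (hσ : σ.IsHermitian) (h : supp ρ ≤ supp σ) : ∃ X, ρ = X * σ := by
  obtain ⟨X, hX⟩ := supp_le_supp_iff.1 h
  refine ⟨Xᴴ, ?_⟩
  rw [← hρ.eq, hX, Matrix.conjTranspose_mul, hσ.eq]

/-- With `τ` the pseudo-inverse of `σ` (as `0⁻¹ = 0`), `1 - τ * σ` projects onto the kernel of `σ`,
which `ρ` kills. Hence ρ = ρτσ, and taking adjoints gives the factorization. -/
theorem supp_le_supp_of_ker {ρ σ : Matrix n n ℂ} (hρ : ρ.IsHermitian) (hσ : σ.IsHermitian)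
    (h : ∀ v, σ *ᵥ v = 0 → ρ *ᵥ v = 0) : supp ρ ≤ supp σ := by
  set τ : Matrix n n ℂ := cfc (fun t : ℝ => t⁻¹) σ
  have hτ : τ.IsHermitian := isHermitian_cfc _ _
  have h1 : σ * (τ * σ) = σ := by
    have hc : Commute τ σ := by
      have := cfc_commute_cfc (fun t : ℝ => t⁻¹) id σ
      rwa [cfc_id ℝ σ hσ.isSelfAdjoint] at this
    rw [hc.eq, mul_cfc hσ, mul_cfc hσ]
    nth_rw 2 [← cfc_id ℝ σ hσ.isSelfAdjoint]
    refine cfc_congr fun t _ => ?_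
    rcases eq_or_ne t 0 with rfl | ht
    · simp
    · simp [ht]
  have h2 : ρ * (1 - τ * σ) = 0 := by
    ext i j
    have h3 : σ *ᵥ ((1 - τ * σ) *ᵥ Pi.single j 1) = 0 := by
      rw [Matrix.mulVec_mulVec, Matrix.mul_sub, h1, Matrix.mul_one, sub_self, Matrix.zero_mulVec]
    have := congrFun (h _ h3) i
    rwa [Matrix.mulVec_mulVec, Matrix.mulVec_single_one] at this
  rw [supp_le_supp_iff]
  refine ⟨τ * ρ, ?_⟩
  have h3 : ρ = ρ * (τ * σ) := by
    rw [Matrix.mul_sub, sub_eq_zero, Matrix.mul_one] at h2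
    exact h2
  have := congrArg Matrix.conjTranspose h3
  simpa [Matrix.conjTranspose_mul, hρ.eq, hσ.eq, hτ.eq, Matrix.mul_assoc] using this

theorem supp_le_supp_of_posSemidef_sub {ρ σ : Matrix n n ℂ} (hρ : ρ.PosSemidef)
    (h : (σ - ρ).PosSemidef) : supp ρ ≤ supp σ := by
  have hσ : σ.IsHermitian := by simpa using h.1.add hρ.1
  refine supp_le_supp_of_ker hρ.1 hσ fun v hv => ?_
  have h1 := hρ.dotProduct_mulVec_nonneg v
  have h2 := h.dotProduct_mulVec_nonneg v
  rw [Matrix.sub_mulVec, hv, zero_sub, dotProduct_neg] at h2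
  exact (hρ.dotProduct_mulVec_zero_iff v).1 (le_antisymm (neg_nonneg.1 h2) h1)

theorem supp_le_supp_of_posDef (ρ : Matrix n n ℂ) {σ : Matrix n n ℂ} (hσ : σ.PosDef) :
    supp ρ ≤ supp σ :=
  supp_le_supp_iff.2 ⟨σ⁻¹ * ρ, by
    rw [← Matrix.mul_assoc, Matrix.mul_nonsing_inv _ ((Matrix.isUnit_iff_isUnit_det _).1 hσ.isUnit),
      Matrix.one_mul]⟩

theorem supp_le_supp_smul {ρ σ : Matrix n n ℂ} {c : ℝ} (hc : c ≠ 0) (h : supp ρ ≤ supp σ) :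
    supp ρ ≤ supp (c • σ) := by
  obtain ⟨X, rfl⟩ := supp_le_supp_iff.1 h
  exact supp_le_supp_iff.2 ⟨c⁻¹ • X, by
    rw [Matrix.smul_mul, Matrix.mul_smul, smul_smul, mul_inv_cancel₀ hc, one_smul]⟩

theorem smul_supp_le_smul_supp {ρ σ : Matrix n n ℂ} (c : ℝ) (h : supp ρ ≤ supp σ) :
    supp (c • ρ) ≤ supp (c • σ) := by
  obtain ⟨X, rfl⟩ := supp_le_supp_iff.1 h
  exact supp_le_supp_iff.2 ⟨X, by rw [Matrix.smul_mul]⟩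

theorem supp_conj_le_supp_conj {V : Matrix m n ℂ} (hV : Vᴴ * V = 1) {ρ σ : Matrix n n ℂ}
    (h : supp ρ ≤ supp σ) : supp (V * ρ * Vᴴ) ≤ supp (V * σ * Vᴴ) := by
  obtain ⟨X, rfl⟩ := supp_le_supp_iff.1 h
  refine supp_le_supp_iff.2 ⟨V * X * Vᴴ, ?_⟩
  calc V * (σ * X) * Vᴴ = V * σ * (1 : Matrix n n ℂ) * X * Vᴴ := by
        simp only [Matrix.mul_assoc, Matrix.mul_one]
    _ = _ := by rw [← hV]; simp only [Matrix.mul_assoc]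

end Support

/-! ### Block diagonal operators -/

section Block

variable {n m X : Type*} [Fintype n] [DecidableEq n] [Fintype m] [DecidableEq m] [Fintype X]
  [DecidableEq X]

/-- The block diagonal operator with blocks `M x`, on a space indexed by `m ≃ n × X`. -/
def blockOp (e : m ≃ n × X) (M : X → Matrix n n ℂ) : Matrix m m ℂ :=
  (Matrix.blockDiagonal M).submatrix e e

/-- `blockOp` as an algebra homomorphism. -/
def blockOpHom (e : m ≃ n × X) : (X → Matrix n n ℂ) →ₐ[ℝ] Matrix m m ℂ where
  toFun := blockOp e
  map_one' := by simp [blockOp]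
  map_mul' M N := by
    rw [blockOp, Pi.mul_def, Matrix.blockDiagonal_mul, blockOp, blockOp,
      Matrix.submatrix_mul_equiv]
  map_zero' := by simp [blockOp]
  map_add' M N := by rw [blockOp, Matrix.blockDiagonal_add]; rfl
  commutes' r := by
    rw [Algebra.algebraMap_eq_smul_one, blockOp, Matrix.blockDiagonal_smul,
      Matrix.blockDiagonal_one, Algebra.algebraMap_eq_smul_one, Matrix.submatrix_smul]
    exact congrArg (fun N : Matrix m m ℂ => r • N) (Matrix.submatrix_one_equiv e)

theorem blockOp_apply (e : m ≃ n × X) (M : X → Matrix n n ℂ) (i j : m) :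
    blockOp e M i j = if (e i).2 = (e j).2 then M (e i).2 (e i).1 (e j).1 else 0 :=
  Matrix.blockDiagonal_apply _ _ _

theorem blockOp_mul (e : m ≃ n × X) (M N : X → Matrix n n ℂ) :
    blockOp e M * blockOp e N = blockOp e fun x => M x * N x :=
  (map_mul (blockOpHom e) M N).symm

theorem blockOp_sub (e : m ≃ n × X) (M N : X → Matrix n n ℂ) :
    blockOp e M - blockOp e N = blockOp e fun x => M x - N x :=
  (map_sub (blockOpHom e) M N).symm

theorem conjTranspose_blockOp (e : m ≃ n × X) (M : X → Matrix n n ℂ) :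
    (blockOp e M)ᴴ = blockOp e fun x => (M x)ᴴ := by
  rw [blockOp, Matrix.conjTranspose_submatrix, Matrix.blockDiagonal_conjTranspose, blockOp]

theorem isHermitian_blockOp (e : m ≃ n × X) {M : X → Matrix n n ℂ}
    (hM : ∀ x, (M x).IsHermitian) : (blockOp e M).IsHermitian := by
  rw [Matrix.IsHermitian, conjTranspose_blockOp]
  simp only [(hM _).eq]

theorem trace_blockOp (e : m ≃ n × X) (M : X → Matrix n n ℂ) :
    (blockOp e M).trace = ∑ x, (M x).trace := by
  rw [← Matrix.trace_blockDiagonal, blockOp, Matrix.trace, Matrix.trace]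
  exact e.sum_comp fun i => (Matrix.blockDiagonal M).diag i

theorem posSemidef_blockOp (e : m ≃ n × X) {M : X → Matrix n n ℂ}
    (hM : ∀ x, (M x).PosSemidef) : (blockOp e M).PosSemidef := by
  have h : blockOp e M = (blockOp e fun x => cfc Real.sqrt (M x))ᴴ *
      blockOp e fun x => cfc Real.sqrt (M x) := by
    rw [conjTranspose_blockOp, blockOp_mul]
    congr 1
    funext x
    rw [(isHermitian_cfc _ _).eq, cfc_mul_cfc]
    nth_rw 1 [← cfc_id ℝ (M x) (hM x).1.isSelfAdjoint]
    exact cfc_congr fun t ht => (Real.mul_self_sqrt (spectrum_nonneg_of_posSemidef (hM x) ht)).symm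
  rw [h]
  exact Matrix.posSemidef_conjTranspose_mul_self _

theorem posDef_blockOp (e : m ≃ n × X) {M : X → Matrix n n ℂ}
    (hM : ∀ x, (M x).PosDef) : (blockOp e M).PosDef := by
  refine ((posSemidef_blockOp e fun x => (hM x).posSemidef).posDef_iff_isUnit).2 ?_
  refine IsUnit.of_mul_eq_one (blockOp e fun x => (M x)⁻¹) ?_
  rw [blockOp_mul]
  have : (fun x => M x * (M x)⁻¹) = 1 := by
    funext x
    exact Matrix.mul_nonsing_inv _ ((Matrix.isUnit_iff_isUnit_det _).1 (hM x).isUnit)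
  rw [this]
  exact map_one (blockOpHom e)

/-- One polynomial interpolates `f` on the spectra of all blocks and of the whole operator, and
algebra homomorphisms commute with polynomials. -/
theorem cfc_blockOp (e : m ≃ n × X) {M : X → Matrix n n ℂ} (hM : ∀ x, (M x).IsHermitian)
    (f : ℝ → ℝ) : cfc f (blockOp e M) = blockOp e fun x => cfc f (M x) := by
  obtain ⟨q, hq⟩ := exists_polynomial_eval_eq
    ((Set.finite_iUnion fun x => (M x).finite_real_spectrum).union
      (blockOp e M).finite_real_spectrum) f
  rw [cfc_eq_aeval (isHermitian_blockOp e hM) (q := q) fun t ht => hq t (Or.inr ht)]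
  have h := Polynomial.aeval_algHom_apply (blockOpHom e) M q
  refine h.trans (congrArg (blockOp e) (funext fun x => ?_))
  rw [cfc_eq_aeval (hM x) (q := q) fun t ht => hq t (Or.inl (Set.mem_iUnion.2 ⟨x, ht⟩))]
  exact (Polynomial.aeval_algHom_apply (Pi.evalAlgHom ℝ (fun _ : X => Matrix n n ℂ) x) M q).symm

end Block

/-! ### Roots, logarithms and supports of block diagonal operators -/

section BlockRoots

variable {n m X : Type u} [Fintype n] [DecidableEq n] [Fintype m] [DecidableEq m] [Fintype X]
  [DecidableEq X]

theorem msqrt_blockOp (e : m ≃ n × X) {M : X → Matrix n n ℂ} (hM : ∀ x, (M x).IsHermitian) :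
    msqrt (blockOp e M) = blockOp e fun x => msqrt (M x) := cfc_blockOp e hM _

theorem minvsqrt_blockOp (e : m ≃ n × X) {M : X → Matrix n n ℂ} (hM : ∀ x, (M x).IsHermitian) :
    minvsqrt (blockOp e M) = blockOp e fun x => minvsqrt (M x) := cfc_blockOp e hM _

theorem mlog_blockOp (e : m ≃ n × X) {M : X → Matrix n n ℂ} (hM : ∀ x, (M x).IsHermitian) :
    mlog (blockOp e M) = blockOp e fun x => mlog (M x) := cfc_blockOp e hM _

theorem supp_blockOp_le (e : m ≃ n × X) {M N : X → Matrix n n ℂ}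
    (h : ∀ x, supp (M x) ≤ supp (N x)) : supp (blockOp e M) ≤ supp (blockOp e N) := by
  choose Y hY using fun x => supp_le_supp_iff.1 (h x)
  refine supp_le_supp_iff.2 ⟨blockOp e Y, ?_⟩
  rw [blockOp_mul]
  exact congrArg _ (funext hY)

end BlockRoots

/-! ### Invariance, additivity and scaling of Bures distance and relative entropy -/

section Distances

variable {n m X : Type u} [Fintype n] [DecidableEq n] [Fintype m] [DecidableEq m] [Fintype X]
  [DecidableEq X]

theorem traceNorm_nonneg (M : Matrix n n ℂ) : 0 ≤ traceNorm M :=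
  (Complex.nonneg_iff.1 (posSemidef_msqrt _).trace_nonneg).1

theorem buresSq_eq (τ ς : Matrix n n ℂ) :
    buresSq τ ς = 2 * (1 - traceNorm (msqrt τ * msqrt ς)) := by
  rw [buresSq, fidelity, Real.sqrt_sq (traceNorm_nonneg _)]

theorem trace_conj_isometry {V : Matrix m n ℂ} (hV : Vᴴ * V = 1) (M : Matrix n n ℂ) :
    (V * M * Vᴴ).trace = M.trace := by
  rw [Matrix.trace_mul_comm, ← Matrix.mul_assoc, hV, Matrix.one_mul]

theorem conj_isometry_mul {V : Matrix m n ℂ} (hV : Vᴴ * V = 1) (M N : Matrix n n ℂ) :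
    (V * M * Vᴴ) * (V * N * Vᴴ) = V * (M * N) * Vᴴ := by
  calc (V * M * Vᴴ) * (V * N * Vᴴ) = V * M * (Vᴴ * V) * N * Vᴴ := by
        simp only [Matrix.mul_assoc]
    _ = _ := by rw [hV, Matrix.mul_one]; simp only [Matrix.mul_assoc]

theorem traceNorm_conj_isometry {V : Matrix m n ℂ} (hV : Vᴴ * V = 1) (M : Matrix n n ℂ) :
    traceNorm (V * M * Vᴴ) = traceNorm M := by
  have h : (V * M * Vᴴ)ᴴ * (V * M * Vᴴ) = V * (Mᴴ * M) * Vᴴ := by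
    rw [← conj_isometry_mul hV]
    simp only [Matrix.conjTranspose_mul, Matrix.conjTranspose_conjTranspose, Matrix.mul_assoc]
  rw [traceNorm, h, msqrt_conj hV (Matrix.isHermitian_conjTranspose_mul_self M),
    trace_conj_isometry hV, traceNorm]

theorem traceNorm_smul {c : ℝ} (hc : 0 ≤ c) (M : Matrix n n ℂ) :
    traceNorm (c • M) = c * traceNorm M := by
  have h : (c • M)ᴴ * (c • M) = (c * c) • (Mᴴ * M) := by
    rw [Matrix.conjTranspose_smul, Matrix.smul_mul, Matrix.mul_smul, smul_smul, star_trivial]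
  rw [traceNorm, h, msqrt_smul (by positivity) (Matrix.isHermitian_conjTranspose_mul_self M),
    Real.sqrt_mul_self hc, Matrix.trace_smul, Complex.smul_re, traceNorm, smul_eq_mul]

theorem traceNorm_blockOp (e : m ≃ n × X) (M : X → Matrix n n ℂ) :
    traceNorm (blockOp e M) = ∑ x, traceNorm (M x) := by
  rw [traceNorm, conjTranspose_blockOp, blockOp_mul,
    msqrt_blockOp e fun x => Matrix.isHermitian_conjTranspose_mul_self (M x), trace_blockOp,
    Complex.re_sum]
  rfl

theorem buresSq_conj_isometry {V : Matrix m n ℂ} (hV : Vᴴ * V = 1) {τ ς : Matrix n n ℂ}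
    (hτ : τ.IsHermitian) (hς : ς.IsHermitian) :
    buresSq (V * τ * Vᴴ) (V * ς * Vᴴ) = buresSq τ ς := by
  rw [buresSq_eq, buresSq_eq, msqrt_conj hV hτ, msqrt_conj hV hς, conj_isometry_mul hV,
    traceNorm_conj_isometry hV]

/-- The squared Bures distance of two classical-quantum operators with the same classical
distribution. -/
theorem buresSq_blockOp (e : m ≃ n × X) {p : X → ℝ} (hp : IsProb p) {τ ς : X → Matrix n n ℂ}
    (hτ : ∀ x, (τ x).IsHermitian) (hς : ∀ x, (ς x).IsHermitian) :
    buresSq (blockOp e fun x => p x • τ x) (blockOp e fun x => p x • ς x) =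
      ∑ x, p x * buresSq (τ x) (ς x) := by
  have h (x) : traceNorm (msqrt (p x • τ x) * msqrt (p x • ς x)) =
      p x * traceNorm (msqrt (τ x) * msqrt (ς x)) := by
    rw [msqrt_smul (hp.1 x) (hτ x), msqrt_smul (hp.1 x) (hς x), Matrix.smul_mul, Matrix.mul_smul,
      smul_smul, Real.mul_self_sqrt (hp.1 x), traceNorm_smul (hp.1 x)]
  rw [buresSq_eq, msqrt_blockOp e fun x => (hτ x).smul (IsSelfAdjoint.all (p x)),
    msqrt_blockOp e fun x => (hς x).smul (IsSelfAdjoint.all (p x)), blockOp_mul, traceNorm_blockOp]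
  simp only [buresSq_eq, h]
  have : ∀ x, p x * (2 * (1 - traceNorm (msqrt (τ x) * msqrt (ς x)))) =
      2 * p x - 2 * (p x * traceNorm (msqrt (τ x) * msqrt (ς x))) := fun x => by ring
  rw [Finset.sum_congr rfl fun x _ => this x, Finset.sum_sub_distrib, ← Finset.mul_sum, hp.2,
    ← Finset.mul_sum]
  ring

/-- The real number `Tr {ρ (log ρ - log σ)}`. -/
def umegaki (ρ σ : Matrix n n ℂ) : ℝ := (ρ * (mlog ρ - mlog σ)).trace.re

theorem relEntropy_eq {ρ σ : Matrix n n ℂ} (h : supp ρ ≤ supp σ) :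
    relEntropy ρ σ = (umegaki ρ σ : EReal) := if_pos h

theorem umegaki_conj_isometry {V : Matrix m n ℂ} (hV : Vᴴ * V = 1) {ρ σ : Matrix n n ℂ}
    (hρ : ρ.IsHermitian) (hσ : σ.IsHermitian) :
    umegaki (V * ρ * Vᴴ) (V * σ * Vᴴ) = umegaki ρ σ := by
  rw [umegaki, mlog_conj hV hρ, mlog_conj hV hσ, ← Matrix.sub_mul, ← Matrix.mul_sub,
    conj_isometry_mul hV, trace_conj_isometry hV, umegaki]

theorem umegaki_blockOp (e : m ≃ n × X) {ρ σ : X → Matrix n n ℂ}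
    (hρ : ∀ x, (ρ x).IsHermitian) (hσ : ∀ x, (σ x).IsHermitian) :
    umegaki (blockOp e ρ) (blockOp e σ) = ∑ x, umegaki (ρ x) (σ x) := by
  rw [umegaki, mlog_blockOp e hρ, mlog_blockOp e hσ, blockOp_sub, blockOp_mul, trace_blockOp,
    Complex.re_sum]
  rfl

theorem mul_mlog_smul_of_supp_le {c : ℝ} (hc : c ≠ 0) {ρ σ : Matrix n n ℂ}
    (hρ : ρ.IsHermitian) (hσ : σ.IsHermitian) (h : supp ρ ≤ supp σ) :
    ρ * mlog (c • σ) = Real.log c • ρ + ρ * mlog σ := by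
  obtain ⟨X, rfl⟩ := exists_eq_mul_right_of_supp_le hρ hσ h
  rw [Matrix.mul_assoc, mul_mlog_smul hc hσ, Matrix.mul_add, Matrix.mul_smul, Matrix.mul_assoc]

theorem umegaki_smul_right {c : ℝ} (hc : c ≠ 0) {ρ σ : Matrix n n ℂ}
    (hρ : ρ.IsHermitian) (hσ : σ.IsHermitian) (h : supp ρ ≤ supp σ) :
    umegaki ρ (c • σ) = umegaki ρ σ - Real.log c * ρ.trace.re := by
  rw [umegaki, Matrix.mul_sub, mul_mlog_smul_of_supp_le hc hρ hσ h, umegaki, Matrix.mul_sub]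
  simp only [Matrix.trace_sub, Matrix.trace_add, Matrix.trace_smul, Complex.sub_re,
    Complex.add_re, Complex.smul_re, smul_eq_mul]
  ring

theorem umegaki_smul_left (c : ℝ) {ρ : Matrix n n ℂ} (σ : Matrix n n ℂ)
    (hρ : ρ.IsHermitian) :
    umegaki (c • ρ) σ = c * umegaki ρ σ + c * Real.log c * ρ.trace.re := by
  rcases eq_or_ne c 0 with rfl | hc
  · simp [umegaki]
  rw [umegaki, Matrix.mul_sub, Matrix.smul_mul, mul_mlog_smul hc hρ, umegaki, Matrix.mul_sub]
  simp only [Matrix.trace_sub, Matrix.trace_add, Matrix.trace_smul, Complex.sub_re,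
    Complex.add_re, Complex.smul_re, smul_eq_mul, Matrix.smul_mul]
  ring

/-- The two contributions of log c cancel. The value `c = 0` has to be allowed, since probabilities
may vanish. -/
theorem umegaki_smul_smul (c : ℝ) {ρ σ : Matrix n n ℂ}
    (hρ : ρ.IsHermitian) (hσ : σ.IsHermitian) (h : supp ρ ≤ supp σ) :
    umegaki (c • ρ) (c • σ) = c * umegaki ρ σ := by
  rcases eq_or_ne c 0 with rfl | hc
  · simp [umegaki]
  rw [umegaki_smul_left c _ hρ, umegaki_smul_right hc hρ hσ h]
  ring

end Distances

/-! ### Partial traces and tensoring with the identity -/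

section PartialTrace

variable {A B C X : Type u} [Fintype A] [DecidableEq A] [Fintype B] [DecidableEq B]
  [Fintype C] [DecidableEq C] [Fintype X] [DecidableEq X]

/-- The partial trace over the left factor as a linear map. -/
def trLeftLM (A B : Type u) [Fintype A] : Matrix (A × B) (A × B) ℂ →ₗ[ℂ] Matrix B B ℂ where
  toFun := trLeft
  map_add' M N := by ext; simp [trLeft, Finset.sum_add_distrib]
  map_smul' c M := by ext; simp [trLeft, Finset.mul_sum]

theorem trLeft_smul (c : ℝ) (M : Matrix (A × B) (A × B) ℂ) :
    trLeft (c • M) = c • trLeft M := (trLeftLM A B).map_smul_of_tower c M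

theorem trLeft_add (M N : Matrix (A × B) (A × B) ℂ) :
    trLeft (M + N) = trLeft M + trLeft N := (trLeftLM A B).map_add M N

theorem trLeft_sum {ι : Type*} (s : Finset ι) (M : ι → Matrix (A × B) (A × B) ℂ) :
    trLeft (∑ i ∈ s, M i) = ∑ i ∈ s, trLeft (M i) := map_sum (trLeftLM A B) M s

theorem trLeft_eq_sum (M : Matrix (A × B) (A × B) ℂ) :
    trLeft M = ∑ a, M.submatrix (Prod.mk a) (Prod.mk a) := by
  ext; simp [trLeft, Matrix.sum_apply]

theorem trace_trLeft (M : Matrix (A × B) (A × B) ℂ) : (trLeft M).trace = M.trace := by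
  simp only [Matrix.trace, Matrix.diag_apply, trLeft, Matrix.of_apply]
  rw [Fintype.sum_prod_type, Finset.sum_comm]

theorem posSemidef_trLeft {M : Matrix (A × B) (A × B) ℂ} (hM : M.PosSemidef) :
    (trLeft M).PosSemidef := by
  rw [trLeft_eq_sum]
  exact Matrix.posSemidef_sum _ fun a _ => hM.submatrix _

theorem isDensity_trLeft {M : Matrix (A × B) (A × B) ℂ} (hM : IsDensity M) :
    IsDensity (trLeft M) :=
  ⟨posSemidef_trLeft hM.1, (trace_trLeft M).trans hM.2⟩

theorem isHermitian_trLeft {M : Matrix (A × B) (A × B) ℂ} (hM : M.IsHermitian) :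
    (trLeft M).IsHermitian := by
  rw [trLeft_eq_sum]
  simp only [Matrix.IsHermitian, Matrix.conjTranspose_sum, (hM.submatrix _).eq]

theorem trLeft_blockOp (M : X → Matrix B B ℂ) :
    trLeft (blockOp (Equiv.prodComm X B) M) = ∑ x, M x := by
  ext b b'
  simp [trLeft, blockOp_apply, Matrix.sum_apply]

/-- Viewing I ⊗ M as equal blocks lets the functional calculus of block operators apply to it. -/
theorem one_kronecker_eq_blockOp (M : Matrix B B ℂ) :
    (1 : Matrix A A ℂ) ⊗ₖ M = blockOp (Equiv.prodComm A B) fun _ => M := by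
  ext x y
  by_cases h : x.1 = y.1 <;> simp [blockOp_apply, Matrix.kroneckerMap_apply, Matrix.one_apply, h]

/-- Moving the middle tensor factor to the right. -/
def midEquiv (A B C : Type u) : A × B × C ≃ (A × C) × B where
  toFun x := ((x.1, x.2.2), x.2.1)
  invFun x := (x.1.1, x.2, x.1.2)
  left_inv _ := rfl
  right_inv _ := rfl

theorem midEquiv_apply (x : A × B × C) : midEquiv A B C x = ((x.1, x.2.2), x.2.1) := rfl

theorem tensorIdMiddle_eq_blockOp (M : Matrix (A × C) (A × C) ℂ) :
    tensorIdMiddle B M = blockOp (midEquiv A B C) fun _ => M := by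
  ext x y
  by_cases h : x.2.1 = y.2.1 <;> simp [tensorIdMiddle, blockOp_apply, midEquiv_apply,
    Matrix.one_apply, h]

theorem trMiddle_blockOp (M : B → Matrix (A × C) (A × C) ℂ) :
    trMiddle (blockOp (midEquiv A B C) M) = ∑ b, M b := by
  ext x y
  simp [trMiddle, blockOp_apply, midEquiv_apply, Matrix.sum_apply]

theorem trLeft_blockOp_mid (M : B → Matrix (A × C) (A × C) ℂ) :
    trLeft (blockOp (midEquiv A B C) M) =
      blockOp (Equiv.prodComm B C) fun b => trLeft (M b) := by
  ext x y
  by_cases h : x.1 = y.1 <;> simp [trLeft, blockOp_apply, midEquiv_apply, h]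

theorem one_kronecker_blockOp (M : B → Matrix C C ℂ) :
    (1 : Matrix A A ℂ) ⊗ₖ blockOp (Equiv.prodComm B C) M =
      blockOp (midEquiv A B C) fun b => (1 : Matrix A A ℂ) ⊗ₖ M b := by
  ext x y
  by_cases h : x.2.1 = y.2.1 <;> simp [blockOp_apply, midEquiv_apply, h, Matrix.kroneckerMap_apply]

theorem trLeft_tensorIdMiddle (M : Matrix (A × C) (A × C) ℂ) :
    trLeft (tensorIdMiddle B M) = (1 : Matrix B B ℂ) ⊗ₖ trLeft M := by
  rw [tensorIdMiddle_eq_blockOp, trLeft_blockOp_mid, one_kronecker_eq_blockOp]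

theorem trLeft_trMiddle (ω : Matrix (A × B × C) (A × B × C) ℂ) :
    trLeft (trMiddle ω) = trLeft (trLeft ω) := by
  ext c c'
  simp only [trLeft, trMiddle, Matrix.of_apply]
  exact Finset.sum_comm

theorem trMiddle_eq_trLeft (ω : Matrix (A × B × C) (A × B × C) ℂ) :
    trMiddle ω = trLeft (ω.submatrix ((Equiv.prodComm _ _).trans (midEquiv A B C).symm)
      ((Equiv.prodComm B (A × C)).trans (midEquiv A B C).symm)) := rfl

theorem posSemidef_trMiddle {ω : Matrix (A × B × C) (A × B × C) ℂ} (hω : ω.PosSemidef) :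
    (trMiddle ω).PosSemidef := by
  rw [trMiddle_eq_trLeft]
  exact posSemidef_trLeft (hω.submatrix _)

theorem trace_trMiddle (ω : Matrix (A × B × C) (A × B × C) ℂ) :
    (trMiddle ω).trace = ω.trace := by
  rw [← trace_trLeft, trLeft_trMiddle, trace_trLeft, trace_trLeft]

theorem isHermitian_one_kronecker {M : Matrix B B ℂ} (hM : M.IsHermitian) :
    ((1 : Matrix A A ℂ) ⊗ₖ M).IsHermitian := by
  rw [one_kronecker_eq_blockOp]
  exact isHermitian_blockOp _ fun _ => hM

theorem posDef_one_kronecker {M : Matrix B B ℂ} (hM : M.PosDef) :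
    ((1 : Matrix A A ℂ) ⊗ₖ M).PosDef := by
  rw [one_kronecker_eq_blockOp]
  exact posDef_blockOp _ fun _ => hM

theorem minvsqrt_one_kronecker {M : Matrix B B ℂ} (hM : M.IsHermitian) :
    minvsqrt ((1 : Matrix A A ℂ) ⊗ₖ M) = 1 ⊗ₖ minvsqrt M := by
  rw [one_kronecker_eq_blockOp, minvsqrt_blockOp _ fun _ => hM, one_kronecker_eq_blockOp]

theorem one_kronecker_mul (M N : Matrix B B ℂ) :
    (1 : Matrix A A ℂ) ⊗ₖ M * 1 ⊗ₖ N = 1 ⊗ₖ (M * N) := by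
  rw [← Matrix.mul_kronecker_mul, Matrix.one_mul]

theorem one_kronecker_smul (c : ℝ) (M : Matrix B B ℂ) :
    (1 : Matrix A A ℂ) ⊗ₖ (c • M) = c • (1 ⊗ₖ M) := Matrix.kronecker_smul c 1 M

theorem isHermitian_petzPartialTrace (σ : Matrix (A × B) (A × B) ℂ) {Y : Matrix B B ℂ}
    (hY : Y.IsHermitian) : (petzPartialTrace σ Y).IsHermitian := by
  have h1 : (minvsqrt (trLeft σ) * Y * minvsqrt (trLeft σ)).IsHermitian := by
    have := Matrix.isHermitian_mul_mul_conjTranspose (minvsqrt (trLeft σ)) hY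
    rwa [(isHermitian_minvsqrt _).eq] at this
  have := Matrix.isHermitian_mul_mul_conjTranspose (msqrt σ)
    (isHermitian_one_kronecker (A := A) h1)
  rwa [(isHermitian_msqrt _).eq] at this

theorem petzPartialTrace_smul (σ : Matrix (A × B) (A × B) ℂ) (c : ℝ) (Y : Matrix B B ℂ) :
    petzPartialTrace σ (c • Y) = c • petzPartialTrace σ Y := by
  simp only [petzPartialTrace, Matrix.mul_smul, Matrix.smul_mul, one_kronecker_smul]

theorem IsDensity.nonempty {n : Type u} [Fintype n] {ρ : Matrix n n ℂ} (h : IsDensity ρ) :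
    Nonempty n := by
  by_contra hn
  rw [not_nonempty_iff] at hn
  have := h.2
  simp [Matrix.trace] at this

end PartialTrace

/-! ### Depolarizing the left factor by signed permutations -/

section Twirl

variable {A B C : Type u} [Fintype A] [DecidableEq A] [Fintype B] [DecidableEq B]
  [Fintype C] [DecidableEq C]

/-- A signed permutation matrix. -/
def signedPerm (s : Equiv.Perm A × (A → Bool)) : Matrix A A ℂ :=
  Matrix.of fun a c => (if s.2 a then 1 else -1) * if s.1 a = c then 1 else 0

theorem signedPerm_mul_conjTranspose (s : Equiv.Perm A × (A → Bool)) :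
    signedPerm s * (signedPerm s)ᴴ = 1 := by
  ext a a'
  rw [Matrix.mul_apply, Finset.sum_eq_single (s.1 a)]
  · rcases eq_or_ne a a' with rfl | h
    · cases h : s.2 a <;> simp [signedPerm, h]
    · have : s.1 a' ≠ s.1 a := fun h' => h (s.1.injective h').symm
      simp [signedPerm, h, this]
  · intro c _ hc
    simp [signedPerm, hc.symm]
  · simp

/-- A signed permutation of the left tensor factor. -/
def twirlOp (B : Type u) [DecidableEq B] (s : Equiv.Perm A × (A → Bool)) :
    Matrix (A × B) (A × B) ℂ := signedPerm s ⊗ₖ 1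

theorem twirlOp_isometry (s : Equiv.Perm A × (A → Bool)) :
    (twirlOp B s)ᴴ * twirlOp B s = 1 := by
  rw [mul_eq_one_comm, twirlOp, Matrix.conjTranspose_kronecker, ← Matrix.mul_kronecker_mul,
    signedPerm_mul_conjTranspose, Matrix.conjTranspose_one, Matrix.one_mul,
    Matrix.one_kronecker_one]

theorem twirlOp_mul_one_kronecker (s : Equiv.Perm A × (A → Bool)) (Y : Matrix B B ℂ) :
    twirlOp B s * ((1 : Matrix A A ℂ) ⊗ₖ Y) = (1 ⊗ₖ Y) * twirlOp B s := by
  rw [twirlOp, ← Matrix.mul_kronecker_mul, ← Matrix.mul_kronecker_mul]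
  simp

theorem twirlOp_conj_apply (s : Equiv.Perm A × (A → Bool)) (M : Matrix (A × B) (A × B) ℂ)
    (x y : A × B) : (twirlOp B s * M * (twirlOp B s)ᴴ) x y =
      (if s.2 x.1 then 1 else -1) * (if s.2 y.1 then 1 else -1) *
        M (s.1 x.1, x.2) (s.1 y.1, y.2) := by
  have h1 (z : A × B) : (twirlOp B s * M) x z =
      (if s.2 x.1 then 1 else -1) * M (s.1 x.1, x.2) z := by
    rw [Matrix.mul_apply, Finset.sum_eq_single (s.1 x.1, x.2)]
    · simp [twirlOp, signedPerm]
    · rintro ⟨c, d⟩ _ hc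
      have : ¬ (s.1 x.1 = c ∧ x.2 = d) := fun h => hc (by simp [h.1, h.2])
      rw [not_and_or] at this
      rcases this with h | h <;> simp [twirlOp, signedPerm, h, Matrix.one_apply]
    · simp
  rw [Matrix.mul_apply, Finset.sum_eq_single (s.1 y.1, y.2)]
  · rw [h1]
    cases h : s.2 y.1 <;> simp [twirlOp, signedPerm, h]
  · rintro ⟨c, d⟩ _ hc
    have : ¬ (s.1 y.1 = c ∧ y.2 = d) := fun h => hc (by simp [h.1, h.2])
    rw [not_and_or] at this
    rcases this with h | h <;> simp [twirlOp, signedPerm, h, Matrix.one_apply]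
  · simp

theorem sum_sign_mul_sign (a a' : A) :
    ∑ ε : A → Bool, (if ε a then (1 : ℂ) else -1) * (if ε a' then 1 else -1) =
      if a = a' then (Fintype.card (A → Bool) : ℂ) else 0 := by
  rcases eq_or_ne a a' with rfl | h
  · have : ∀ ε : A → Bool, (if ε a then (1 : ℂ) else -1) * (if ε a then 1 else -1) = 1 := by
      intro ε; cases ε a <;> simp
    simp [this]
  · rw [if_neg h]
    -- Flipping the sign at `a` alone permutes the sign vectors and negates every summand.
    have := (Equiv.piCongrRight fun i : A => if i = a then Equiv.boolNot else Equiv.refl _).sum_comp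
      fun ε : A → Bool => (if ε a then (1 : ℂ) else -1) * (if ε a' then 1 else -1)
    have h2 : ∀ ε : A → Bool, (if (Equiv.piCongrRight
        (fun i : A => if i = a then Equiv.boolNot else Equiv.refl Bool)) ε a then (1 : ℂ) else -1) *
        (if (Equiv.piCongrRight
          (fun i : A => if i = a then Equiv.boolNot else Equiv.refl Bool)) ε a' then 1 else -1) =
        -((if ε a then (1 : ℂ) else -1) * (if ε a' then 1 else -1)) := by
      intro ε
      cases h3 : ε a <;> cases h4 : ε a' <;> simp [h.symm, h3, h4]
    rw [Finset.sum_congr rfl fun ε _ => h2 ε, Finset.sum_neg_distrib] at this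
    exact self_eq_neg.1 this.symm

/-- By composition with a transposition the sum over permutations does not depend on `a`; summing it
over all points gives the identity. -/
theorem card_mul_sum_perm (f : A → ℂ) (a : A) :
    (Fintype.card A : ℂ) * ∑ π : Equiv.Perm A, f (π a) =
      Fintype.card (Equiv.Perm A) * ∑ c, f c := by
  have h1 : ∀ a' : A, ∑ π : Equiv.Perm A, f (π a') = ∑ π : Equiv.Perm A, f (π a) := by
    intro a'
    have := Equiv.sum_comp (Equiv.mulRight (Equiv.swap a a')) fun π : Equiv.Perm A => f (π a')
    simpa using this.symm
  have h2 : ∑ a' : A, ∑ π : Equiv.Perm A, f (π a') =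
      ∑ π : Equiv.Perm A, ∑ c, f c := by
    rw [Finset.sum_comm]
    exact Finset.sum_congr rfl fun π _ => Equiv.sum_comp π f
  rw [Finset.sum_congr rfl fun a' _ => h1 a'] at h2
  simpa using h2

/-- Averaging over signed permutations of the left factor depolarizes it. -/
theorem card_smul_sum_twirl (M : Matrix (A × B) (A × B) ℂ) :
    (Fintype.card A : ℝ) • ∑ s, twirlOp B s * M * (twirlOp B s)ᴴ =
      (Fintype.card (Equiv.Perm A × (A → Bool)) : ℝ) • ((1 : Matrix A A ℂ) ⊗ₖ trLeft M) := by
  ext ⟨a, b⟩ ⟨a', b'⟩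
  rw [Matrix.smul_apply, Matrix.smul_apply, Matrix.sum_apply]
  simp only [twirlOp_conj_apply]
  rw [Fintype.sum_prod_type]
  -- The sum over signs kills the blocks with a ≠ a'; the permutations then average the diagonal
  -- blocks.
  simp only [← Finset.sum_mul, sum_sign_mul_sign]
  rcases eq_or_ne a a' with rfl | h
  · simp only [if_true, ← Finset.mul_sum, Complex.real_smul, Fintype.card_prod]
    have := card_mul_sum_perm (fun c => M (c, b) (c, b')) a
    push_cast
    rw [mul_left_comm, this]
    simp [trLeft]
    ring
  · simp [h]

/-- Up to a positive scalar, I ⊗ ω_B is the sum of the twirled copies of ω. The trivial signed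
permutation contributes ω itself and the others are positive, so ω is dominated. -/
theorem supp_le_supp_one_kronecker_trLeft {ω : Matrix (A × B) (A × B) ℂ} (hω : ω.PosSemidef) :
    supp ω ≤ supp ((1 : Matrix A A ℂ) ⊗ₖ trLeft ω) := by
  cases isEmpty_or_nonempty A with
  | inl h =>
    have : ω = 0 := Subsingleton.elim _ _
    exact supp_le_supp_iff.2 ⟨0, by rw [this, Matrix.mul_zero]⟩
  | inr h =>
    have hA : (0 : ℝ) < Fintype.card A := by exact_mod_cast Fintype.card_pos
    have hX : (0 : ℝ) < Fintype.card (Equiv.Perm A × (A → Bool)) := by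
      exact_mod_cast Fintype.card_pos
    have h1 : (1 : Matrix A A ℂ) ⊗ₖ trLeft ω =
        ((Fintype.card (Equiv.Perm A × (A → Bool)) : ℝ)⁻¹ * (Fintype.card A : ℝ)) •
          ∑ s, twirlOp B s * ω * (twirlOp B s)ᴴ := by
      rw [mul_smul, card_smul_sum_twirl, smul_smul, inv_mul_cancel₀ hX.ne', one_smul]
    rw [h1]
    refine supp_le_supp_smul (by positivity) (supp_le_supp_of_posSemidef_sub hω ?_)
    have h2 : twirlOp B ((1, fun _ => true) : Equiv.Perm A × (A → Bool)) = 1 := by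
      have : signedPerm ((1, fun _ => true) : Equiv.Perm A × (A → Bool)) = 1 := by
        ext i j
        by_cases h : i = j <;> simp [signedPerm, Matrix.one_apply, h]
      rw [twirlOp, this, Matrix.one_kronecker_one]
    rw [← Finset.add_sum_erase _ _ (Finset.mem_univ
      ((1, fun _ => true) : Equiv.Perm A × (A → Bool))), h2]
    simp only [Matrix.one_mul, Matrix.conjTranspose_one, Matrix.mul_one, add_sub_cancel_left]
    exact Matrix.posSemidef_sum _ fun s _ => hω.mul_mul_conjTranspose_same _

theorem supp_le_supp_tensorIdMiddle_trMiddle {ω : Matrix (A × B × C) (A × B × C) ℂ}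
    (hω : ω.PosSemidef) : supp ω ≤ supp (tensorIdMiddle B (trMiddle ω)) := by
  set e := (Equiv.prodComm B (A × C)).trans (midEquiv A B C).symm
  obtain ⟨Y, hY⟩ := supp_le_supp_iff.1 (supp_le_supp_one_kronecker_trLeft (hω.submatrix e))
  refine supp_le_supp_iff.2 ⟨Y.submatrix e.symm e.symm, ?_⟩
  have h1 : tensorIdMiddle B (trMiddle ω) = ((1 : Matrix B B ℂ) ⊗ₖ
      trLeft (ω.submatrix e e)).submatrix e.symm e.symm := by
    rw [← trMiddle_eq_trLeft]
    ext x y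
    exact mul_comm _ _
  rw [h1, Matrix.submatrix_mul_equiv, ← hY]
  simp

end Twirl

/-! ### Ensemble averages and the concavity gap -/

section Averages

theorem ereal_coe_sum {ι : Type*} (s : Finset ι) (f : ι → ℝ) :
    ((∑ i ∈ s, f i : ℝ) : EReal) = ∑ i ∈ s, (f i : EReal) := by
  classical
  induction s using Finset.induction_on with
  | empty => simp
  | insert a s ha ih => rw [Finset.sum_insert ha, Finset.sum_insert ha, EReal.coe_add, ih]

variable {n X A B : Type u} [Fintype n] [DecidableEq n] [Fintype X] [Fintype A] [DecidableEq A]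
  [Fintype B] [DecidableEq B]

theorem isHermitian_real_smul {M : Matrix n n ℂ} (hM : M.IsHermitian) (c : ℝ) :
    (c • M).IsHermitian := hM.smul (IsSelfAdjoint.all c)

theorem posSemidef_real_smul {M : Matrix n n ℂ} (hM : M.PosSemidef) {c : ℝ} (hc : 0 ≤ c) :
    (c • M).PosSemidef := hM.smul hc

theorem IsDensity.average {p : X → ℝ} (hp : IsProb p) {ρ : X → Matrix n n ℂ}
    (hρ : ∀ x, IsDensity (ρ x)) : IsDensity (∑ x, p x • ρ x) := by
  refine ⟨Matrix.posSemidef_sum _ fun x _ => posSemidef_real_smul (hρ x).1 (hp.1 x), ?_⟩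
  simp only [Matrix.trace_sum, Matrix.trace_smul, (hρ _).2, Complex.real_smul, mul_one]
  exact_mod_cast hp.2

theorem trace_trLeft_mul (M : Matrix (A × B) (A × B) ℂ) (Y : Matrix B B ℂ) :
    (trLeft M * Y).trace = (M * ((1 : Matrix A A ℂ) ⊗ₖ Y)).trace := by
  rw [← trace_trLeft (M * _)]
  congr 1
  ext b b'
  simp only [trLeft, Matrix.of_apply, Matrix.mul_apply, Fintype.sum_prod_type,
    Matrix.kroneckerMap_apply, Matrix.one_apply, Finset.sum_mul, ite_mul, one_mul, zero_mul,
    mul_ite, mul_zero]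
  rw [Finset.sum_comm]
  refine Finset.sum_congr rfl fun a _ => ?_
  rw [Finset.sum_comm]
  simp

theorem umegaki_one_kronecker {ρ : Matrix (A × B) (A × B) ℂ} {τ : Matrix B B ℂ}
    (hτ : τ.IsHermitian) : umegaki ρ ((1 : Matrix A A ℂ) ⊗ₖ τ) =
      (ρ * mlog ρ).trace.re - (trLeft ρ * mlog τ).trace.re := by
  rw [umegaki, Matrix.mul_sub, Matrix.trace_sub, Complex.sub_re, trace_trLeft_mul,
    one_kronecker_eq_blockOp, mlog_blockOp _ fun _ => hτ, ← one_kronecker_eq_blockOp]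

theorem sum_mul_trace_re (p : X → ℝ) (ρ : X → Matrix n n ℂ) (Y : Matrix n n ℂ) :
    ∑ x, p x * (ρ x * Y).trace.re = ((∑ x, p x • ρ x) * Y).trace.re := by
  simp only [Matrix.sum_mul, Matrix.trace_sum, Complex.re_sum, Matrix.smul_mul,
    Matrix.trace_smul, Complex.smul_re, smul_eq_mul]

/-- The concavity gap of the conditional entropy, in terms of relative entropies to the average. -/
theorem condEntropy_sub_sum_condEntropy {p : X → ℝ} (hp : IsProb p)
    {ρ : X → Matrix (A × B) (A × B) ℂ} (hρ : ∀ x, IsDensity (ρ x)) :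
    condEntropy (∑ y, p y • ρ y) - ∑ x, (p x : EReal) * condEntropy (ρ x) =
      ((∑ x, p x * (umegaki (ρ x) (∑ y, p y • ρ y) -
        umegaki (trLeft (ρ x)) (trLeft (∑ y, p y • ρ y))) : ℝ) : EReal) := by
  have hcond {τ : Matrix (A × B) (A × B) ℂ} (hτ : IsDensity τ) : condEntropy τ =
      ((-((τ * mlog τ).trace.re - (trLeft τ * mlog (trLeft τ)).trace.re) : ℝ) : EReal) := by
    rw [condEntropy, relEntropy_eq (supp_le_supp_one_kronecker_trLeft hτ.1),
      umegaki_one_kronecker (isHermitian_trLeft hτ.1.1), EReal.coe_neg]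
  have hB : trLeft (∑ y, p y • ρ y) = ∑ y, p y • trLeft (ρ y) := by
    simp only [trLeft_sum, trLeft_smul]
  rw [hcond (IsDensity.average hp hρ)]
  simp only [hcond (hρ _), ← EReal.coe_mul, ← ereal_coe_sum, ← EReal.coe_sub]
  congr 1
  -- The trace against a fixed logarithm is linear in the state, so the entropy terms of the average
  -- spread over the ensemble.
  have h1 := sum_mul_trace_re p ρ (mlog (∑ y, p y • ρ y))
  have h2 := sum_mul_trace_re p (fun x => trLeft (ρ x)) (mlog (trLeft (∑ y, p y • ρ y)))
  rw [← hB] at h2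
  rw [← h1, ← h2, ← Finset.sum_sub_distrib, ← Finset.sum_neg_distrib, ← Finset.sum_sub_distrib]
  refine Finset.sum_congr rfl fun x _ => ?_
  simp only [umegaki, Matrix.mul_sub, Matrix.trace_sub, Complex.sub_re]
  ring

end Averages

/-! ### Implications by choice of operators -/

section Implications

/-- The classical register takes the role of B in ω = ⊕ p(x)ρ^x, so ω_AC is the average state. The
terms p log p cancel, since ρ^x and its partial trace have equal trace. -/
theorem StrongSubadditivity.concavityCondEntropy (h : StrongSubadditivity.{u}) :
    ConcavityCondEntropy.{u} := by
  classical
  intro X A B _ _ _ _ _ p ρ hp hρ hB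
  rw [condEntropy_sub_sum_condEntropy hp hρ]
  set τ := ∑ y, p y • ρ y with hτ
  have hτd : IsDensity τ := IsDensity.average hp hρ
  set ω : Matrix (A × X × B) (A × X × B) ℂ :=
    blockOp (midEquiv A X B) fun x => p x • ρ x with hω
  have hωd : IsDensity ω := by
    refine ⟨posSemidef_blockOp _ fun x => posSemidef_real_smul (hρ x).1 (hp.1 x), ?_⟩
    rw [hω, trace_blockOp, ← Matrix.trace_sum]
    exact hτd.2
  have hAC : trMiddle ω = τ := trMiddle_blockOp _
  have hBC : trLeft ω = blockOp (Equiv.prodComm X B) fun x => p x • trLeft (ρ x) := by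
    rw [hω, trLeft_blockOp_mid]
    simp only [trLeft_smul]
  have hC : trLeft (trLeft ω) = trLeft τ := by rw [← trLeft_trMiddle, hAC]
  have key := h A X B ω hωd (by rw [hC]; exact hB)
  have hherm (x) : (trLeft (ρ x)).IsHermitian := isHermitian_trLeft (hρ x).1.1
  have hpetz : petzCtoAC ω (trLeft ω) = blockOp (midEquiv A X B) fun x =>
      p x • petzPartialTrace τ (trLeft (ρ x)) := by
    simp only [petzCtoAC, hAC, hC]
    rw [hBC, tensorIdMiddle_eq_blockOp, one_kronecker_eq_blockOp (minvsqrt _), blockOp_mul, blockOp_mul,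
      one_kronecker_blockOp, blockOp_mul, blockOp_mul]
    simp only [← petzPartialTrace_smul]
    rfl
  rw [hpetz, buresSq_blockOp _ hp (fun x => (hρ x).1.1)
    (fun x => isHermitian_petzPartialTrace τ (hherm x))] at key
  refine key.trans_eq ?_
  rw [condMutualInfo, relEntropy_eq (supp_le_supp_tensorIdMiddle_trMiddle hωd.1),
    relEntropy_eq (supp_le_supp_of_posDef _ (posDef_one_kronecker (by rw [hC]; exact hB))),
    ← EReal.coe_sub]
  congr 1
  rw [hAC, hC, hBC, tensorIdMiddle_eq_blockOp, one_kronecker_eq_blockOp,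
    umegaki_blockOp _ (fun x => isHermitian_real_smul (hρ x).1.1 _) (fun _ => hτd.1.1),
    umegaki_blockOp _ (fun x => isHermitian_real_smul (hherm x) _) (fun _ => hB.1),
    ← Finset.sum_sub_distrib]
  refine Finset.sum_congr rfl fun x _ => ?_
  rw [umegaki_smul_left _ _ (hρ x).1.1, umegaki_smul_left _ _ (hherm x), trace_trLeft]
  ring

/-- Take σ = ω_AC ⊗ I_B/|B|. Its partial trace is I_B ⊗ ω_C/|B|; the factor 1/|B| cancels in the
Petz map and shifts both relative entropies equally. -/
theorem MonotonicityPartialTrace.strongSubadditivity (h : MonotonicityPartialTrace.{u}) :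
    StrongSubadditivity.{u} := by
  intro A B C _ _ _ _ _ _ ω hω hC
  have hne : Nonempty B := hω.nonempty.map fun x => x.2.1
  have hB : (0 : ℝ) < Fintype.card B := by exact_mod_cast Fintype.card_pos
  set c : ℝ := (Fintype.card B : ℝ)⁻¹
  have hc : 0 < c := inv_pos.2 hB
  set T := tensorIdMiddle B (trMiddle ω) with hT
  have hACp := posSemidef_trMiddle hω.1
  have hTp : T.PosSemidef := by
    rw [hT, tensorIdMiddle_eq_blockOp]
    exact posSemidef_blockOp _ fun _ => hACp
  have hσ : IsDensity (c • T) := by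
    refine ⟨posSemidef_real_smul hTp hc.le, ?_⟩
    rw [Matrix.trace_smul, hT, tensorIdMiddle_eq_blockOp, trace_blockOp]
    simp only [trace_trMiddle, hω.2]
    rw [Finset.sum_const, Finset.card_univ, nsmul_eq_mul, mul_one, Complex.real_smul]
    exact_mod_cast inv_mul_cancel₀ hB.ne'
  have hTsupp : supp ω ≤ supp T := supp_le_supp_tensorIdMiddle_trMiddle hω.1
  have htr : trLeft (c • T) = c • ((1 : Matrix B B ℂ) ⊗ₖ trLeft (trLeft ω)) := by
    rw [trLeft_smul, hT, trLeft_tensorIdMiddle, trLeft_trMiddle]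
  have hKp : ((1 : Matrix B B ℂ) ⊗ₖ trLeft (trLeft ω)).PosDef := posDef_one_kronecker hC
  have hcKp : (c • ((1 : Matrix B B ℂ) ⊗ₖ trLeft (trLeft ω))).PosDef := hKp.smul hc
  have key := h A (B × C) ω (c • T) hω hσ (supp_le_supp_smul hc.ne' hTsupp) (by rw [htr]; exact hcKp)
  have hpetz : petzPartialTrace (c • T) (trLeft ω) = petzCtoAC ω (trLeft ω) := by
    have hs : Real.sqrt c ≠ 0 := (Real.sqrt_pos.2 hc).ne'
    simp only [petzCtoAC, petzPartialTrace]
    rw [htr, minvsqrt_smul hc.le hKp.1, msqrt_smul hc.le hTp.1, minvsqrt_one_kronecker hC.1]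
    have hsT : msqrt T = tensorIdMiddle B (msqrt (trMiddle ω)) := by
      rw [hT, tensorIdMiddle_eq_blockOp, msqrt_blockOp _ fun _ => hACp.1,
        tensorIdMiddle_eq_blockOp]
    rw [hsT]
    simp only [Matrix.smul_mul, Matrix.mul_smul, one_kronecker_smul, smul_smul]
    rw [show Real.sqrt c * ((Real.sqrt c)⁻¹ * (Real.sqrt c)⁻¹ * Real.sqrt c) = 1 by field_simp,
      one_smul]
  rw [hpetz] at key
  refine key.trans_eq ?_
  rw [condMutualInfo, htr, relEntropy_eq hTsupp, relEntropy_eq (supp_le_supp_smul hc.ne' hTsupp),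
    relEntropy_eq (supp_le_supp_of_posDef _ hKp), relEntropy_eq (supp_le_supp_of_posDef _ hcKp),
    umegaki_smul_right hc.ne' hω.1.1 hTp.1 hTsupp,
    umegaki_smul_right hc.ne' (isHermitian_trLeft hω.1.1) hKp.1 (supp_le_supp_of_posDef _ hKp),
    trace_trLeft, ← EReal.coe_sub, ← EReal.coe_sub]
  congr 1
  ring

/-- For ⊕ p(x)ρ_x and ⊕ p(x)σ_x, tracing out the register leaves the two averages, and both sides
split over the blocks. -/
theorem MonotonicityPartialTrace.jointConvexity (h : MonotonicityPartialTrace.{u}) :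
    JointConvexity.{u} := by
  classical
  intro X S _ _ _ p ρ σ hp hρ hσ hsupp hpos
  set e := Equiv.prodComm X S
  set τ := ∑ y, p y • ρ y with hτ
  set κ := ∑ y, p y • σ y with hκ
  have hd {ν : X → Matrix S S ℂ} (hν : ∀ x, IsDensity (ν x)) :
      IsDensity (blockOp e fun x => p x • ν x) := by
    refine ⟨posSemidef_blockOp _ fun x => posSemidef_real_smul (hν x).1 (hp.1 x), ?_⟩
    rw [trace_blockOp, ← Matrix.trace_sum]
    exact (IsDensity.average hp hν).2
  have hs : supp (blockOp e fun x => p x • ρ x) ≤ supp (blockOp e fun x => p x • σ x) :=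
    supp_blockOp_le _ fun x => smul_supp_le_smul_supp _ (hsupp x)
  have key := h X S _ _ (hd hρ) (hd hσ) hs (by rw [trLeft_blockOp]; exact hpos)
  have hpetz : petzPartialTrace (blockOp e fun x => p x • σ x) τ = blockOp e fun x =>
      p x • (msqrt (σ x) * minvsqrt κ * τ * minvsqrt κ * msqrt (σ x)) := by
    rw [petzPartialTrace, trLeft_blockOp, one_kronecker_eq_blockOp,
      msqrt_blockOp _ fun x => isHermitian_real_smul (hσ x).1.1 _, blockOp_mul, blockOp_mul]
    congr 1
    funext x
    rw [msqrt_smul (hp.1 x) (hσ x).1.1]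
    simp only [Matrix.smul_mul, Matrix.mul_smul, smul_smul, Real.mul_self_sqrt (hp.1 x),
      Matrix.mul_assoc, hκ]
  rw [trLeft_blockOp, trLeft_blockOp, hpetz, buresSq_blockOp _ hp (fun x => (hρ x).1.1)] at key
  · refine key.trans_eq ?_
    congr 1
    rw [relEntropy_eq hs, umegaki_blockOp _ (fun x => isHermitian_real_smul (hρ x).1.1 _)
      (fun x => isHermitian_real_smul (hσ x).1.1 _), ereal_coe_sum]
    refine Finset.sum_congr rfl fun x _ => ?_
    rw [umegaki_smul_smul _ (hρ x).1.1 (hσ x).1.1 (hsupp x), EReal.coe_mul,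
      relEntropy_eq (hsupp x)]
  · intro x
    have := Matrix.isHermitian_mul_mul_conjTranspose (msqrt (σ x) * minvsqrt κ)
      (IsDensity.average hp hρ).1.1
    simpa only [Matrix.conjTranspose_mul, (isHermitian_msqrt _).eq, (isHermitian_minvsqrt _).eq,
      Matrix.mul_assoc] using this

/-- Apply joint convexity to the uniform ensemble of twirled pairs. Unitary invariance makes all
summands equal, and the averages I/|A| ⊗ ρ_B and I/|A| ⊗ σ_B have the relative entropy of ρ_B and
σ_B. -/
theorem JointConvexity.monotonicityPartialTrace (h : JointConvexity.{u}) :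
    MonotonicityPartialTrace.{u} := by
  intro A B _ _ _ _ ρ σ hρ hσ hsupp hpos
  have hne : Nonempty A := hρ.nonempty.map Prod.fst
  have hA : (0 : ℝ) < Fintype.card A := by exact_mod_cast Fintype.card_pos
  have hX : (0 : ℝ) < Fintype.card (Equiv.Perm A × (A → Bool)) := by
    exact_mod_cast Fintype.card_pos
  set c : ℝ := (Fintype.card A : ℝ)⁻¹ with hc_def
  have hc : 0 < c := inv_pos.2 hA
  set p : Equiv.Perm A × (A → Bool) → ℝ :=
    fun _ => (Fintype.card (Equiv.Perm A × (A → Bool)) : ℝ)⁻¹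
  have hp : IsProb p := ⟨fun _ => (inv_pos.2 hX).le, by
    rw [Finset.sum_const, Finset.card_univ, nsmul_eq_mul, mul_inv_cancel₀ hX.ne']⟩
  have hiso := twirlOp_isometry (A := A) (B := B)
  have havg (M : Matrix (A × B) (A × B) ℂ) :
      ∑ s, p s • (twirlOp B s * M * (twirlOp B s)ᴴ) = c • ((1 : Matrix A A ℂ) ⊗ₖ trLeft M) := by
    rw [← Finset.smul_sum]
    have := congrArg (fun N => (c * (Fintype.card (Equiv.Perm A × (A → Bool)) : ℝ)⁻¹) • N)
      (card_smul_sum_twirl M)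
    simp only [smul_smul] at this
    rw [mul_right_comm, hc_def, inv_mul_cancel₀ hA.ne', one_mul, mul_assoc,
      inv_mul_cancel₀ hX.ne', mul_one] at this
    exact this
  have hd {ν : Matrix (A × B) (A × B) ℂ} (hν : IsDensity ν) (s) :
      IsDensity (twirlOp B s * ν * (twirlOp B s)ᴴ) :=
    ⟨hν.1.mul_mul_conjTranspose_same _, (trace_conj_isometry (hiso s) ν).trans hν.2⟩
  have hKp : ((1 : Matrix A A ℂ) ⊗ₖ trLeft σ).PosDef := posDef_one_kronecker hpos
  have hcKp : (c • ((1 : Matrix A A ℂ) ⊗ₖ trLeft σ)).PosDef := hKp.smul hc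
  have hρB := isHermitian_trLeft hρ.1.1
  have key := h _ (A × B) p (fun s => twirlOp B s * ρ * (twirlOp B s)ᴴ)
    (fun s => twirlOp B s * σ * (twirlOp B s)ᴴ) hp (hd hρ) (hd hσ)
    (fun s => supp_conj_le_supp_conj (hiso s) hsupp) (by rw [havg]; exact hcKp)
  rw [havg, havg] at key
  have hpetz (s) : msqrt (twirlOp B s * σ * (twirlOp B s)ᴴ) *
      minvsqrt (c • ((1 : Matrix A A ℂ) ⊗ₖ trLeft σ)) * (c • ((1 : Matrix A A ℂ) ⊗ₖ trLeft ρ)) *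
      minvsqrt (c • ((1 : Matrix A A ℂ) ⊗ₖ trLeft σ)) * msqrt (twirlOp B s * σ * (twirlOp B s)ᴴ) =
      twirlOp B s * petzPartialTrace σ (trLeft ρ) * (twirlOp B s)ᴴ := by
    have hsq : Real.sqrt c ≠ 0 := (Real.sqrt_pos.2 hc).ne'
    set Z := minvsqrt (trLeft σ) * trLeft ρ * minvsqrt (trLeft σ) with hZ
    have h1 : minvsqrt (c • ((1 : Matrix A A ℂ) ⊗ₖ trLeft σ)) *
        (c • ((1 : Matrix A A ℂ) ⊗ₖ trLeft ρ)) *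
        minvsqrt (c • ((1 : Matrix A A ℂ) ⊗ₖ trLeft σ)) = (1 : Matrix A A ℂ) ⊗ₖ Z := by
      rw [minvsqrt_smul hc.le hKp.1, minvsqrt_one_kronecker hpos.1]
      simp only [Matrix.smul_mul, Matrix.mul_smul, smul_smul, one_kronecker_mul, hZ]
      rw [show (Real.sqrt c)⁻¹ * (c * (Real.sqrt c)⁻¹) = 1 by
        field_simp; exact (Real.sq_sqrt hc.le).symm, one_smul]
    -- The twirl acts on A only, so it commutes with I ⊗ Z; the Petz operator is therefore
    -- covariant.
    have h2 : (1 : Matrix A A ℂ) ⊗ₖ Z = twirlOp B s * (1 ⊗ₖ Z) * (twirlOp B s)ᴴ := by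
      rw [twirlOp_mul_one_kronecker, Matrix.mul_assoc, mul_eq_one_comm.1 (hiso s), Matrix.mul_one]
    have h3 (P K R : Matrix (A × B) (A × B) ℂ) : P * K * R * K * P = P * (K * R * K) * P := by
      simp only [Matrix.mul_assoc]
    rw [msqrt_conj (hiso s) hσ.1.1, h3, h1, h2, conj_isometry_mul (hiso s),
      conj_isometry_mul (hiso s), petzPartialTrace]
  have hb (s) := buresSq_conj_isometry (hiso s) hρ.1.1 (isHermitian_petzPartialTrace σ hρB)
  have hr (s) : relEntropy (twirlOp B s * ρ * (twirlOp B s)ᴴ) (twirlOp B s * σ * (twirlOp B s)ᴴ) =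
      (umegaki ρ σ : EReal) := by
    rw [relEntropy_eq (supp_conj_le_supp_conj (hiso s) hsupp),
      umegaki_conj_isometry (hiso s) hρ.1.1 hσ.1.1]
  simp only [hpetz, hb, hr] at key
  rw [← Finset.sum_mul, hp.2, one_mul] at key
  refine key.trans_eq ?_
  simp only [← EReal.coe_mul]
  rw [← ereal_coe_sum, ← Finset.sum_mul, hp.2, one_mul, relEntropy_eq hsupp]
  congr 1
  rw [relEntropy_eq (supp_le_supp_of_posDef _ hcKp), relEntropy_eq (supp_le_supp_of_posDef _ hpos),
    umegaki_smul_smul _ (isHermitian_one_kronecker hρB) hKp.1 (supp_le_supp_of_posDef _ hKp),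
    one_kronecker_eq_blockOp, one_kronecker_eq_blockOp,
    umegaki_blockOp _ (fun _ => hρB) (fun _ => hpos.1), Finset.sum_const, Finset.card_univ,
    nsmul_eq_mul, ← mul_assoc, hc_def, inv_mul_cancel₀ hA.ne', one_mul]

end Implications

/-! ### Stinespring dilation and channels -/

section Dilation

variable {S B E : Type u} [Fintype S] [DecidableEq S] [Fintype B] [DecidableEq B]
  [Fintype E] [DecidableEq E]

/-- The adjoint of the partial trace is tensoring with the identity, and that of conjugation by `V`
is conjugation by `Vᴴ`. -/
theorem hsAdjoint_of_dilation {N : Matrix S S ℂ →ₗ[ℂ] Matrix B B ℂ} {V : Matrix (E × B) S ℂ}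
    (hN : ∀ M, N M = trLeft (V * M * Vᴴ)) (Y : Matrix B B ℂ) :
    hsAdjoint N Y = Vᴴ * ((1 : Matrix E E ℂ) ⊗ₖ Y) * V := by
  ext i j
  have h : (N (Matrix.single i j 1))ᴴ = N (Matrix.single j i 1) := by
    rw [hN, hN]
    ext b b'
    have : (V * Matrix.single i j (1 : ℂ) * Vᴴ)ᴴ =
        V * Matrix.single j i (1 : ℂ) * Vᴴ := by
      simp [Matrix.conjTranspose_mul, Matrix.conjTranspose_single, Matrix.mul_assoc]
    rw [← this]
    simp [trLeft]
  have h2 : V * Matrix.single j i (1 : ℂ) * Vᴴ * ((1 : Matrix E E ℂ) ⊗ₖ Y) =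
      V * (Matrix.single j i (1 : ℂ) * (Vᴴ * ((1 : Matrix E E ℂ) ⊗ₖ Y))) := by
    simp only [Matrix.mul_assoc]
  rw [hsAdjoint, Matrix.of_apply, h, hN, trace_trLeft_mul, h2, Matrix.trace_mul_comm,
    Matrix.mul_assoc, Matrix.trace_single_mul, one_smul]

theorem isometry_of_dilation {N : Matrix S S ℂ →ₗ[ℂ] Matrix B B ℂ} {V : Matrix (E × B) S ℂ}
    (hN : ∀ M, N M = trLeft (V * M * Vᴴ)) (htr : ∀ M, (N M).trace = M.trace) :
    Vᴴ * V = 1 := by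
  refine Matrix.ext_iff_trace_mul_right.2 fun M => ?_
  rw [Matrix.mul_assoc, Matrix.trace_mul_comm, ← trace_trLeft, ← hN, htr, Matrix.one_mul]

/-- Stinespring's dilation theorem. -/
theorem IsCPTP.exists_dilation {N : Matrix S S ℂ →ₗ[ℂ] Matrix B B ℂ} (hN : IsCPTP N) :
    ∃ V : Matrix ((S × B) × B) S ℂ, Vᴴ * V = 1 ∧ ∀ M, N M = trLeft (V * M * Vᴴ) := by
  -- The Choi matrix of `N`; it is positive as the image of the unnormalized maximally entangled
  -- projector `v v†` under the ampliation.
  set C : Matrix (S × B) (S × B) ℂ :=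
    Matrix.of fun x y => N (Matrix.single x.1 y.1 1) x.2 y.2 with hC
  have hCp : C.PosSemidef := by
    let e := Fintype.equivFin S
    let v : Fin (Fintype.card S) × S → ℂ := fun x => if e.symm x.1 = x.2 then 1 else 0
    have h1 := hN.completelyPositive _ _ (Matrix.posSemidef_vecMulVec_self_star v)
    have h2 : C = (ampliate N _ (Matrix.vecMulVec v (star v))).submatrix
        (Prod.map e id) (Prod.map e id) := by
      ext x y
      have h3 : Matrix.single x.1 y.1 (1 : ℂ) = Matrix.of fun s s' =>
          Matrix.vecMulVec v (star v) (e x.1, s) (e y.1, s') := by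
        ext s t
        simp only [v, Matrix.vecMulVec_apply, Matrix.single_apply, Matrix.of_apply,
          Equiv.symm_apply_apply, Pi.star_apply]
        split_ifs <;> simp_all
      simp only [hC, Matrix.of_apply, h3]
      rfl
    rw [h2]
    exact h1.submatrix _
  -- The rows of √C, conjugated, serve as Kraus operators, and C = √C√C turns their sum into `N`.
  -- The environment is S × B.
  let V : Matrix ((S × B) × B) S ℂ := Matrix.of fun x s => star (msqrt C x.1 (s, x.2))
  have hV : ∀ M, N M = trLeft (V * M * Vᴴ) := by
    intro M
    have h1 : ∀ s t b b', N (Matrix.single s t 1) b b' =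
        ∑ z, star (msqrt C z (s, b)) * msqrt C z (t, b') := by
      intro s t b b'
      have := congrFun (congrFun (msqrt_mul_self hCp) (s, b)) (t, b')
      nth_rw 1 [← (isHermitian_msqrt C).eq] at this
      exact this.symm
    ext b b'
    conv_lhs => rw [Matrix.matrix_eq_sum_single M]
    have h2 : ∀ s t, N (Matrix.single s t (M s t)) b b' =
        M s t * ∑ z, star (msqrt C z (s, b)) * msqrt C z (t, b') := by
      intro s t
      rw [← h1, show Matrix.single s t (M s t) = M s t • Matrix.single s t (1 : ℂ) by
        rw [Matrix.smul_single, smul_eq_mul, mul_one], map_smul, Matrix.smul_apply, smul_eq_mul]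
    simp only [map_sum, Matrix.sum_apply, h2, trLeft, Matrix.of_apply, Matrix.mul_apply,
      Matrix.conjTranspose_apply, V, star_star, Finset.sum_mul, Finset.mul_sum]
    rw [Finset.sum_comm]
    conv_rhs => rw [Finset.sum_comm]
    refine Finset.sum_congr rfl fun t _ => ?_
    conv_rhs => rw [Finset.sum_comm]
    refine Finset.sum_congr rfl fun s _ => Finset.sum_congr rfl fun z _ => ?_
    ring
  exact ⟨V, isometry_of_dilation hV hN.tracePreserving, hV⟩

theorem isCPTP_trLeftLM (A B : Type u) [Fintype A] [DecidableEq A] [Fintype B]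
    [DecidableEq B] : IsCPTP (trLeftLM A B) where
  completelyPositive k M hM := by
    have : ampliate (trLeftLM A B) k M = ∑ a : A, M.submatrix (fun x : Fin k × B => (x.1, a, x.2))
        (fun x : Fin k × B => (x.1, a, x.2)) := by
      ext x y
      simp [ampliate, trLeftLM, trLeft, Matrix.sum_apply]
    rw [this]
    exact Matrix.posSemidef_sum _ fun a _ => hM.submatrix _
  tracePreserving := trace_trLeft

theorem MonotonicityChannel.monotonicityPartialTrace (h : MonotonicityChannel.{u}) :
    MonotonicityPartialTrace.{u} := by
  intro A B _ _ _ _ ρ σ hρ hσ hsupp hpos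
  have key := h (A × B) B ρ σ (trLeftLM A B) hρ hσ hsupp (isCPTP_trLeftLM A B) hpos
  have h1 := hsAdjoint_of_dilation (N := trLeftLM A B) (V := (1 : Matrix (A × B) (A × B) ℂ))
    fun M => by simp [trLeftLM]
  rw [petz, h1] at key
  simpa [petzPartialTrace, trLeftLM] using key

/-- Apply the hub to VρV† and VσV†. Their Petz operator is the channel's one conjugated by `V`, so
isometric invariance removes `V` throughout. -/
theorem MonotonicityPartialTrace.monotonicityChannel (h : MonotonicityPartialTrace.{u}) :
    MonotonicityChannel.{u} := by
  intro S B _ _ _ _ ρ σ N hρ hσ hsupp hN hpos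
  obtain ⟨V, hV, hNV⟩ := hN.exists_dilation
  have hd {ν : Matrix S S ℂ} (hν : IsDensity ν) : IsDensity (V * ν * Vᴴ) :=
    ⟨hν.1.mul_mul_conjTranspose_same _, (trace_conj_isometry hV ν).trans hν.2⟩
  have hs := supp_conj_le_supp_conj hV hsupp
  have key := h _ B _ _ (hd hρ) (hd hσ) hs (by rw [← hNV]; exact hpos)
  have hpetz : petzPartialTrace (V * σ * Vᴴ) (N ρ) = V * petz σ N (N ρ) * Vᴴ := by
    rw [petzPartialTrace, petz, ← hNV, msqrt_conj hV hσ.1.1, hsAdjoint_of_dilation hNV]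
    simp only [Matrix.mul_assoc]
  rw [← hNV, ← hNV, hpetz, buresSq_conj_isometry hV hρ.1.1, relEntropy_eq hs,
    umegaki_conj_isometry hV hρ.1.1 hσ.1.1, ← relEntropy_eq hsupp] at key
  · exact key
  -- What remains is that the channel's Petz operator is Hermitian; this is pulled back along the
  -- isometry.
  · have h1 := isHermitian_petzPartialTrace (V * σ * Vᴴ)
      (hNV ρ ▸ isHermitian_trLeft (hd hρ).1.1 : (N ρ).IsHermitian)
    rw [hpetz] at h1
    have h2 := Matrix.isHermitian_conjTranspose_mul_mul V h1
    have h3 : Vᴴ * (V * petz σ N (N ρ) * Vᴴ) * V = petz σ N (N ρ) := by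
      calc Vᴴ * (V * petz σ N (N ρ) * Vᴴ) * V = (Vᴴ * V) * petz σ N (N ρ) * (Vᴴ * V) := by
            simp only [Matrix.mul_assoc]
        _ = _ := by rw [hV, Matrix.one_mul, Matrix.mul_one]
    rwa [h3] at h2

end Dilation

open Filter Topology

/-! ### Continuity of the functional calculus -/

section Continuity

variable {n : Type*} [Fintype n] [DecidableEq n]

open scoped Matrix.Norms.L2Operator in
/-- Continuity of the functional calculus in the operator. -/
theorem tendsto_cfc_of_isOpen {Y : Type*} {l : Filter Y} {M : Y → Matrix n n ℂ}
    {M₀ : Matrix n n ℂ} (hM : Tendsto M l (𝓝 M₀)) (hh : ∀ y, (M y).IsHermitian)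
    (h₀ : M₀.IsHermitian) {f : ℝ → ℝ} {s : Set ℝ} (hs : IsOpen s) (hsp : spectrum ℝ M₀ ⊆ s)
    (hf : ContinuousOn f s) : Tendsto (fun y => cfc f (M y)) l (𝓝 (cfc f M₀)) := by
  have hc : IsCompact (spectrum ℝ M₀) := M₀.finite_real_spectrum.isCompact
  -- Upper hemicontinuity of the spectrum keeps nearby spectra inside one compact neighbourhood on
  -- which `f` is continuous.
  obtain ⟨k, ⟨hka, hk⟩, hks⟩ := hc.nhdsSet_basis_isCompact.mem_iff.mp (hs.mem_nhdsSet.2 hsp)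
  have hev := (upperHemicontinuous_spectrum ℝ (Matrix n n ℂ)).isOpen k
  have h1 : ∀ᶠ y in l, spectrum ℝ (M y) ⊆ k :=
    (hM.eventually (hev.mem_nhds hka)).mono fun y hy => subset_of_mem_nhdsSet hy
  exact hM.cfc hk f h1 (Eventually.of_forall fun y => (hh y).isSelfAdjoint)
    (subset_of_mem_nhdsSet hka) h₀.isSelfAdjoint (hf.mono hks)

end Continuity

/-! ### Klein's inequality and a quadratic upper bound -/

section Klein

variable {n : Type u} [Fintype n] [DecidableEq n]

/-- The trace of a product of functions of two Hermitian operators is a nonnegative combination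
of products of values at the eigenvalues. -/
theorem exists_weights_trace_cfc_mul_cfc {M N : Matrix n n ℂ} (hM : M.IsHermitian)
    (hN : N.IsHermitian) : ∃ w : n → n → ℝ, (∀ i j, 0 ≤ w i j) ∧ ∀ f g : ℝ → ℝ,
      (cfc f M * cfc g N).trace.re =
        ∑ i, ∑ j, w i j * (f (hM.eigenvalues i) * g (hN.eigenvalues j)) := by
  set U : Matrix n n ℂ := hM.eigenvectorUnitary.1
  set W : Matrix n n ℂ := hN.eigenvectorUnitary.1
  -- The weights are the squared overlaps of the two eigenbases; they do not depend on `f` and `g`,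
  -- so trace inequalities reduce to scalar ones.
  refine ⟨fun i j => Complex.normSq ((Uᴴ * W) i j), fun i j => Complex.normSq_nonneg _,
    fun f g => ?_⟩
  have h1 : cfc f M = U * Matrix.diagonal (fun i => (f (hM.eigenvalues i) : ℂ)) * Uᴴ := by
    rw [hM.cfc_eq]; rfl
  have h2 : cfc g N = W * Matrix.diagonal (fun i => (g (hN.eigenvalues i) : ℂ)) * Wᴴ := by
    rw [hN.cfc_eq]; rfl
  have h3 : (cfc f M * cfc g N).trace =
      (Matrix.diagonal (fun i => (f (hM.eigenvalues i) : ℂ)) * ((Uᴴ * W) *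
        (Matrix.diagonal (fun i => (g (hN.eigenvalues i) : ℂ)) * (Uᴴ * W)ᴴ))).trace := by
    rw [h1, h2, Matrix.conjTranspose_mul, Matrix.conjTranspose_conjTranspose,
      Matrix.mul_assoc U, Matrix.mul_assoc U, Matrix.trace_mul_comm]
    simp only [Matrix.mul_assoc]
  rw [h3, Matrix.trace, Complex.re_sum]
  refine Finset.sum_congr rfl fun i _ => ?_
  rw [Matrix.diag_apply, Matrix.diagonal_mul, Matrix.mul_apply, Finset.mul_sum, Complex.re_sum]
  refine Finset.sum_congr rfl fun j _ => ?_
  rw [Matrix.diagonal_mul, Matrix.conjTranspose_apply, Complex.star_def]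
  have h4 : (f (hM.eigenvalues i) : ℂ) * ((Uᴴ * W) i j * ((g (hN.eigenvalues j) : ℂ) *
      (starRingEnd ℂ) ((Uᴴ * W) i j))) = ((Complex.normSq ((Uᴴ * W) i j) *
        (f (hM.eigenvalues i) * g (hN.eigenvalues j)) : ℝ) : ℂ) := by
    push_cast
    rw [Complex.normSq_eq_conj_mul_self]
    ring
  rw [h4, Complex.ofReal_re]

/-- Klein's inequality. -/
theorem trace_sub_trace_le_umegaki {ρ τ : Matrix n n ℂ} (hρ : ρ.PosSemidef) (hτ : τ.PosDef) :
    ρ.trace.re - τ.trace.re ≤ umegaki ρ τ := by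
  obtain ⟨w, hw, h⟩ := exists_weights_trace_cfc_mul_cfc hρ.1 hτ.1
  have e1 : cfc (id : ℝ → ℝ) ρ = ρ := cfc_id ℝ ρ hρ.1.isSelfAdjoint
  have e2 : cfc (id : ℝ → ℝ) τ = τ := cfc_id ℝ τ hτ.1.isSelfAdjoint
  have e3 : cfc (fun _ : ℝ => (1 : ℝ)) ρ = 1 := cfc_const_one ℝ ρ hρ.1.isSelfAdjoint
  have e4 : cfc (fun _ : ℝ => (1 : ℝ)) τ = 1 := cfc_const_one ℝ τ hτ.1.isSelfAdjoint
  have t1 := h id fun _ => 1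
  have t2 := h (fun _ => 1) id
  have t3 := h (fun t => t * Real.log t) fun _ => 1
  have t4 := h id Real.log
  rw [e1, e4, Matrix.mul_one] at t1
  rw [e3, e2, Matrix.one_mul] at t2
  rw [← mul_cfc hρ.1, e4, Matrix.mul_one] at t3
  rw [e1] at t4
  rw [umegaki, Matrix.mul_sub, Matrix.trace_sub, Complex.sub_re, mlog, mlog, t1, t2, t3, t4,
    ← Finset.sum_sub_distrib, ← Finset.sum_sub_distrib]
  refine Finset.sum_le_sum fun i _ => ?_
  rw [← Finset.sum_sub_distrib, ← Finset.sum_sub_distrib]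
  refine Finset.sum_le_sum fun j _ => ?_
  rw [← mul_sub, ← mul_sub]
  refine mul_le_mul_of_nonneg_left ?_ (hw i j)
  simp only [id]
  have hs := hρ.eigenvalues_nonneg i
  have ht := hτ.eigenvalues_pos j
  rcases hs.eq_or_lt with hs | hs
  · rw [← hs]; simp [ht.le]
  -- The scalar inequality is s - t ≤ s log s - s log t, from log x ≤ x - 1 at x = t/s.
  · have := Real.log_le_sub_one_of_pos (div_pos ht hs)
    rw [Real.log_div ht.ne' hs.ne'] at this
    have h5 := mul_le_mul_of_nonneg_left this hs.le
    rw [mul_sub, mul_sub, mul_div_cancel₀ _ hs.ne'] at h5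
    linarith

/-- Here log x ≤ x - 1 is used at x = s/t, giving s log s - s log t ≤ s²/t - s. For two states close
to each other this bound is of second order. -/
theorem umegaki_le_trace {ρ τ : Matrix n n ℂ} (hρ : ρ.PosSemidef) (hτ : τ.PosDef) :
    umegaki ρ τ ≤ (ρ * ρ * cfc (fun t : ℝ => t⁻¹) τ).trace.re - ρ.trace.re := by
  obtain ⟨w, hw, h⟩ := exists_weights_trace_cfc_mul_cfc hρ.1 hτ.1
  have e1 : cfc (id : ℝ → ℝ) ρ = ρ := cfc_id ℝ ρ hρ.1.isSelfAdjoint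
  have e4 : cfc (fun _ : ℝ => (1 : ℝ)) τ = 1 := cfc_const_one ℝ τ hτ.1.isSelfAdjoint
  have t1 := h id fun _ => 1
  have t2 := h (fun t => t * id t) fun t => t⁻¹
  have t3 := h (fun t => t * Real.log t) fun _ => 1
  have t4 := h id Real.log
  rw [e1, e4, Matrix.mul_one] at t1
  rw [← mul_cfc hρ.1, e1] at t2
  rw [← mul_cfc hρ.1, e4, Matrix.mul_one] at t3
  rw [e1] at t4
  rw [umegaki, Matrix.mul_sub, Matrix.trace_sub, Complex.sub_re, mlog, mlog, t1, t2, t3, t4,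
    ← Finset.sum_sub_distrib, ← Finset.sum_sub_distrib]
  refine Finset.sum_le_sum fun i _ => ?_
  rw [← Finset.sum_sub_distrib, ← Finset.sum_sub_distrib]
  refine Finset.sum_le_sum fun j _ => ?_
  rw [← mul_sub, ← mul_sub]
  refine mul_le_mul_of_nonneg_left ?_ (hw i j)
  simp only [id]
  have hs := hρ.eigenvalues_nonneg i
  have ht := hτ.eigenvalues_pos j
  rcases hs.eq_or_lt with hs | hs
  · rw [← hs]; simp
  · have := Real.log_le_sub_one_of_pos (div_pos hs ht)
    rw [Real.log_div hs.ne' ht.ne'] at this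
    have h5 := mul_le_mul_of_nonneg_left this hs.le
    rw [mul_sub, mul_sub, div_eq_mul_inv] at h5
    linarith

end Klein

/-! ### Nonnegativity of the Bures term -/

section BuresNonneg

variable {n : Type u} [Fintype n] [DecidableEq n]

theorem trace_conjTranspose_mul_self_re_nonneg (M : Matrix n n ℂ) : 0 ≤ (Mᴴ * M).trace.re :=
  (Complex.nonneg_iff.1 (Matrix.posSemidef_conjTranspose_mul_self M).trace_nonneg).1

/-- With M = √τ√ς and G the pseudo-inverse of |M|, MG is the polar partial isometry. For Z = √τMG
one has Tr Z†√ς = ‖M‖₁, and Tr Z†Z ≤ Tr τ because Q = MG²M† is a projection. Expanding Tr (Z -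
√ς)†(Z - √ς) ≥ 0 gives the bound. -/
theorem two_mul_traceNorm_le {τ ς : Matrix n n ℂ} (hτ : τ.PosSemidef) (hς : ς.PosSemidef) :
    2 * traceNorm (msqrt τ * msqrt ς) ≤ τ.trace.re + ς.trace.re := by
  set M := msqrt τ * msqrt ς with hM
  set K := Mᴴ * M with hK
  have hKp : K.PosSemidef := Matrix.posSemidef_conjTranspose_mul_self M
  set G := minvsqrt K with hG
  have hGh : Gᴴ = G := isHermitian_minvsqrt K
  have hτh : (msqrt τ)ᴴ = msqrt τ := isHermitian_msqrt τ
  have hςh : (msqrt ς)ᴴ = msqrt ς := isHermitian_msqrt ς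
  have hKG : K * G = msqrt K := by
    rw [hG, minvsqrt, mul_cfc hKp.1]
    refine cfc_congr fun t ht => ?_
    have ht0 := spectrum_nonneg_of_posSemidef hKp ht
    rw [← div_eq_mul_inv, Real.div_sqrt]
  have hGKG : G * G * K * (G * G) = G * G := by
    have hc : G * G * K = K * (G * G) := by
      have := cfc_commute_cfc (fun t : ℝ => (Real.sqrt t)⁻¹ * (Real.sqrt t)⁻¹) id K
      rw [cfc_id ℝ K hKp.1.isSelfAdjoint, ← cfc_mul_cfc] at this
      exact this.eq
    rw [hc, hG, minvsqrt, cfc_mul_cfc, mul_cfc hKp.1, cfc_mul_cfc]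
    refine cfc_congr fun t ht => ?_
    have ht0 := spectrum_nonneg_of_posSemidef hKp ht
    rcases ht0.eq_or_lt with h | h
    · simp [← h]
    · have h2 := Real.mul_self_sqrt ht0
      have h3 := (Real.sqrt_pos.2 h).ne'
      simp only [← mul_inv, h2]
      field_simp
  set Z := msqrt τ * M * G with hZ
  set Q := M * (G * G) * Mᴴ with hQ
  have hQh : Qᴴ = Q := by
    simp only [hQ, Matrix.conjTranspose_mul, Matrix.conjTranspose_conjTranspose, hGh,
      Matrix.mul_assoc]
  have hQQ : Q * Q = Q := by
    calc Q * Q = M * (G * G * (Mᴴ * M) * (G * G)) * Mᴴ := by simp only [hQ, Matrix.mul_assoc]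
      _ = Q := by rw [← hK, hGKG]
  have hZY : (Zᴴ * msqrt ς).trace = (msqrt K).trace := by
    have : Zᴴ * msqrt ς = G * K := by
      simp only [hZ, hK, Matrix.conjTranspose_mul, hGh, hτh, Matrix.mul_assoc]
      rw [← hM]
    rw [this, Matrix.trace_mul_comm, hKG]
  have hZZ : (Zᴴ * Z).trace = (msqrt τ * Q * msqrt τ).trace := by
    have h1 : Zᴴ * Z = G * Mᴴ * (msqrt τ * (msqrt τ * (M * G))) := by
      simp only [hZ, Matrix.conjTranspose_mul, hGh, hτh, Matrix.mul_assoc]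
    rw [h1, Matrix.trace_mul_comm, Matrix.trace_mul_comm (msqrt τ * Q)]
    simp only [hQ, Matrix.mul_assoc]
  have hYY : ((msqrt ς)ᴴ * msqrt ς).trace = ς.trace := by rw [hςh, msqrt_mul_self hς]
  have h1 := trace_conjTranspose_mul_self_re_nonneg (Z - msqrt ς)
  have h2 := trace_conjTranspose_mul_self_re_nonneg ((1 - Q) * msqrt τ)
  have h3 : ((1 - Q) * msqrt τ)ᴴ * ((1 - Q) * msqrt τ) = τ - msqrt τ * Q * msqrt τ := by
    have : (1 - Q) * (1 - Q) = 1 - Q := by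
      rw [Matrix.mul_sub, Matrix.sub_mul, Matrix.sub_mul, hQQ]; simp
    calc ((1 - Q) * msqrt τ)ᴴ * ((1 - Q) * msqrt τ)
        = msqrt τ * ((1 - Q) * (1 - Q)) * msqrt τ := by
          simp only [Matrix.conjTranspose_mul, Matrix.conjTranspose_sub, hQh, hτh,
            Matrix.conjTranspose_one, Matrix.mul_assoc]
      _ = _ := by
          rw [this, Matrix.mul_sub, Matrix.sub_mul, Matrix.mul_one, msqrt_mul_self hτ]
  have h4 : ((msqrt ς)ᴴ * Z).trace.re = (msqrt K).trace.re := by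
    rw [← hZY, ← Matrix.conjTranspose_conjTranspose Z, ← Matrix.conjTranspose_mul,
      Matrix.trace_conjTranspose, Matrix.conjTranspose_conjTranspose, Complex.star_def,
      Complex.conj_re]
  rw [h3, Matrix.trace_sub, Complex.sub_re, ← hZZ] at h2
  rw [Matrix.conjTranspose_sub, Matrix.sub_mul, Matrix.mul_sub, Matrix.mul_sub] at h1
  simp only [Matrix.trace_sub, Complex.sub_re, h4, hZY, hYY] at h1
  rw [traceNorm, ← hK]
  linarith

theorem buresSq_nonneg {τ ς : Matrix n n ℂ} (hτ : IsDensity τ) (hς : IsDensity ς) :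
    0 ≤ buresSq τ ς := by
  have := two_mul_traceNorm_le hτ.1 hς.1
  rw [hτ.2, hς.2, Complex.one_re] at this
  rw [buresSq_eq]
  linarith

end BuresNonneg

/-! ### The projection onto the kernel -/

section KernelProjection

variable {n : Type u} [Fintype n] [DecidableEq n]

/-- The projection onto the kernel of a Hermitian operator. -/
def kerProj (M : Matrix n n ℂ) : Matrix n n ℂ := cfc (fun t : ℝ => if t = 0 then 1 else 0) M

theorem isHermitian_kerProj (M : Matrix n n ℂ) : (kerProj M).IsHermitian := isHermitian_cfc _ _

theorem posSemidef_kerProj (M : Matrix n n ℂ) : (kerProj M).PosSemidef :=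
  posSemidef_cfc fun t _ => by split_ifs <;> simp

theorem kerProj_mul_self (M : Matrix n n ℂ) : kerProj M * kerProj M = kerProj M := by
  rw [kerProj, cfc_mul_cfc]
  exact cfc_congr fun t _ => by simp

theorem mul_kerProj {M : Matrix n n ℂ} (hM : M.IsHermitian) : M * kerProj M = 0 := by
  rw [kerProj, mul_cfc hM, ← cfc_const_zero ℝ M]
  exact cfc_congr fun t _ => by simp

theorem mul_kerProj_of_supp_le {M N : Matrix n n ℂ} (hN : N.IsHermitian) (hM : M.IsHermitian)
    (h : supp N ≤ supp M) : N * kerProj M = 0 := by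
  obtain ⟨X, rfl⟩ := exists_eq_mul_right_of_supp_le hN hM h
  rw [Matrix.mul_assoc, mul_kerProj hM, Matrix.mul_zero]

/-- The eigenvalue 0 is moved to 1, where the logarithm also vanishes: the operator becomes
invertible and keeps its logarithm. -/
theorem posDef_add_kerProj {M : Matrix n n ℂ} (hM : M.PosSemidef) : (M + kerProj M).PosDef := by
  refine ((hM.add (posSemidef_kerProj M)).posDef_iff_isUnit).2 (IsUnit.of_mul_eq_one
    (cfc (fun t : ℝ => t⁻¹ + if t = 0 then 1 else 0) M) ?_)
  have h1 : M + kerProj M = cfc (fun t : ℝ => id t + if t = 0 then 1 else 0) M := by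
    rw [cfc_add _ _ _ (continuousOn_spectrum M _) (continuousOn_spectrum M _),
      cfc_id ℝ M hM.1.isSelfAdjoint, kerProj]
  rw [h1, cfc_mul_cfc, ← cfc_const_one ℝ M hM.1.isSelfAdjoint]
  refine cfc_congr fun t _ => ?_
  by_cases h : t = 0 <;> simp [h]

theorem mul_cfc_inv {M : Matrix n n ℂ} (hM : M.PosDef) :
    M * cfc (fun t : ℝ => t⁻¹) M = 1 := by
  rw [mul_cfc hM.1, ← cfc_const_one ℝ M hM.1.isSelfAdjoint]
  exact cfc_congr fun t ht => mul_inv_cancel₀ (spectrum_pos_of_posDef hM ht).ne'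

end KernelProjection

open Filter Topology

/-! ### Limits of roots, Petz maps and relative entropies -/

section Limits

variable {n m A B : Type u} [Fintype n] [DecidableEq n] [Fintype m] [DecidableEq m]
  [Fintype A] [DecidableEq A] [Fintype B] [DecidableEq B]
  {Y : Type*} {l : Filter Y}

theorem tendsto_msqrt {M : Y → Matrix n n ℂ} {M₀ : Matrix n n ℂ} (hM : Tendsto M l (𝓝 M₀))
    (hh : ∀ y, (M y).IsHermitian) (h₀ : M₀.IsHermitian) :
    Tendsto (fun y => msqrt (M y)) l (𝓝 (msqrt M₀)) :=
  tendsto_cfc_of_isOpen hM hh h₀ isOpen_univ (Set.subset_univ _) Real.continuous_sqrt.continuousOn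

theorem tendsto_cfc_of_posDef {M : Y → Matrix n n ℂ} {M₀ : Matrix n n ℂ} (hM : Tendsto M l (𝓝 M₀))
    (hh : ∀ y, (M y).IsHermitian) (h₀ : M₀.PosDef) {f : ℝ → ℝ}
    (hf : ContinuousOn f (Set.Ioi 0)) : Tendsto (fun y => cfc f (M y)) l (𝓝 (cfc f M₀)) :=
  tendsto_cfc_of_isOpen hM hh h₀.1 isOpen_Ioi (fun _ ht => spectrum_pos_of_posDef h₀ ht) hf

theorem tendsto_mlog {M : Y → Matrix n n ℂ} {M₀ : Matrix n n ℂ} (hM : Tendsto M l (𝓝 M₀))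
    (hh : ∀ y, (M y).IsHermitian) (h₀ : M₀.PosDef) :
    Tendsto (fun y => mlog (M y)) l (𝓝 (mlog M₀)) :=
  tendsto_cfc_of_posDef hM hh h₀ (Real.continuousOn_log.mono fun _ ht => ne_of_gt ht)

theorem tendsto_minvsqrt {M : Y → Matrix n n ℂ} {M₀ : Matrix n n ℂ} (hM : Tendsto M l (𝓝 M₀))
    (hh : ∀ y, (M y).IsHermitian) (h₀ : M₀.PosDef) :
    Tendsto (fun y => minvsqrt (M y)) l (𝓝 (minvsqrt M₀)) :=
  tendsto_cfc_of_posDef hM hh h₀ (Real.continuous_sqrt.continuousOn.inv₀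
    fun _ ht => (Real.sqrt_pos.2 ht).ne')

theorem tendsto_trace_re {M : Y → Matrix n n ℂ} {M₀ : Matrix n n ℂ} (hM : Tendsto M l (𝓝 M₀)) :
    Tendsto (fun y => (M y).trace.re) l (𝓝 M₀.trace.re) :=
  (Complex.continuous_re.comp continuous_id.matrix_trace).continuousAt.tendsto.comp hM

theorem continuous_trLeft : Continuous (trLeft : Matrix (A × B) (A × B) ℂ → Matrix B B ℂ) :=
  continuous_matrix fun _ _ => continuous_finsetSum _ fun _ _ => continuous_id.matrix_elem _ _

theorem continuous_one_kronecker :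
    Continuous fun M : Matrix B B ℂ => (1 : Matrix A A ℂ) ⊗ₖ M :=
  continuous_matrix fun _ _ => continuous_const.mul (continuous_id.matrix_elem _ _)

theorem tendsto_buresSq (τ : Matrix n n ℂ) {M : Y → Matrix n n ℂ} {M₀ : Matrix n n ℂ}
    (hM : Tendsto M l (𝓝 M₀)) (hh : ∀ y, (M y).IsHermitian) (h₀ : M₀.IsHermitian) :
    Tendsto (fun y => buresSq τ (M y)) l (𝓝 (buresSq τ M₀)) := by
  simp only [buresSq_eq, traceNorm]
  have h1 := (tendsto_const_nhds (x := msqrt τ)).mul (tendsto_msqrt hM hh h₀)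
  have h2 := (continuous_id.matrix_conjTranspose.continuousAt.tendsto.comp h1).mul h1
  exact ((tendsto_trace_re (tendsto_msqrt h2
    (fun y => Matrix.isHermitian_conjTranspose_mul_self _)
    (Matrix.isHermitian_conjTranspose_mul_self _))).const_sub 1).const_mul 2

theorem tendsto_petzPartialTrace {τ : Y → Matrix (A × B) (A × B) ℂ}
    {σ : Matrix (A × B) (A × B) ℂ} (hτ : Tendsto τ l (𝓝 σ)) (hh : ∀ y, (τ y).IsHermitian)
    (hσ : σ.IsHermitian) (hpos : (trLeft σ).PosDef) (ρ : Matrix B B ℂ) :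
    Tendsto (fun y => petzPartialTrace (τ y) ρ) l (𝓝 (petzPartialTrace σ ρ)) := by
  have h1 := tendsto_msqrt hτ hh hσ
  have h2 := tendsto_minvsqrt ((continuous_trLeft.tendsto σ).comp hτ)
    (fun y => isHermitian_trLeft (hh y)) hpos
  have h3 := (h2.mul_const ρ).mul h2
  exact (h1.mul ((continuous_one_kronecker.tendsto _).comp h3)).mul h1

theorem tendsto_umegaki_right (ρ : Matrix n n ℂ) {τ : Y → Matrix n n ℂ} {σ : Matrix n n ℂ}
    (h : Tendsto (fun y => mlog (τ y)) l (𝓝 (mlog σ))) :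
    Tendsto (fun y => umegaki ρ (τ y)) l (𝓝 (umegaki ρ σ)) :=
  tendsto_trace_re (tendsto_const_nhds.mul (h.const_sub _))

theorem isDensity_petzPartialTrace {σ : Matrix (A × B) (A × B) ℂ} (hσ : σ.PosSemidef)
    (hpos : (trLeft σ).PosDef) {ρ : Matrix B B ℂ} (hρ : IsDensity ρ) :
    IsDensity (petzPartialTrace σ ρ) := by
  set K := minvsqrt (trLeft σ) with hK
  have hKh : Kᴴ = K := isHermitian_minvsqrt _
  constructor
  · have h1 : (K * ρ * K).PosSemidef := by
      have := hρ.1.mul_mul_conjTranspose_same K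
      rwa [hKh] at this
    have h2 : ((1 : Matrix A A ℂ) ⊗ₖ (K * ρ * K)).PosSemidef := by
      rw [one_kronecker_eq_blockOp]
      exact posSemidef_blockOp _ fun _ => h1
    have := h2.mul_mul_conjTranspose_same (msqrt σ)
    rwa [(isHermitian_msqrt σ).eq] at this
  · rw [petzPartialTrace, Matrix.trace_mul_comm, ← Matrix.mul_assoc, msqrt_mul_self hσ,
      ← trace_trLeft_mul, ← hK, ← Matrix.mul_assoc, Matrix.trace_mul_comm, ← Matrix.mul_assoc,
      ← Matrix.mul_assoc, minvsqrt_mul_mul_minvsqrt hpos, Matrix.one_mul, hρ.2]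

end Limits

/-! ### The mixtures (1 - t)σ + tρ as t → 0+ -/

section Mixture

variable {n : Type u} [Fintype n] [DecidableEq n]

/-- The mixture `(1 - t) σ + t ρ`. -/
def mix (σ ρ : Matrix n n ℂ) (t : ℝ) : Matrix n n ℂ := (1 - t) • σ + t • ρ

theorem isHermitian_mix {σ ρ : Matrix n n ℂ} (hσ : σ.IsHermitian) (hρ : ρ.IsHermitian) (t : ℝ) :
    (mix σ ρ t).IsHermitian := (isHermitian_real_smul hσ _).add (isHermitian_real_smul hρ _)

theorem posDef_mix {σ ρ : Matrix n n ℂ} (hσ : σ.PosDef) (hρ : ρ.PosSemidef) {t : ℝ}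
    (h0 : 0 ≤ t) (h1 : t < 1) : (mix σ ρ t).PosDef :=
  (hσ.smul (sub_pos.2 h1)).add_posSemidef (posSemidef_real_smul hρ h0)

theorem tendsto_mix (σ ρ : Matrix n n ℂ) : Tendsto (mix σ ρ) (𝓝[>] 0) (𝓝 σ) := by
  have : Continuous (mix σ ρ) :=
    ((continuous_const.sub continuous_id).smul continuous_const).add
      (continuous_id.smul continuous_const)
  have h := (this.tendsto 0).mono_left (nhdsWithin_le_nhds (s := Set.Ioi 0))
  simpa [mix] using h

theorem mix_add_kerProj (σ ρ : Matrix n n ℂ) (t : ℝ) :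
    mix σ ρ t + kerProj σ = mix (σ + kerProj σ) (ρ + kerProj σ) t := by
  simp only [mix, smul_add, sub_smul, one_smul]
  abel

theorem mlog_mix_add_kerProj {σ ρ : Matrix n n ℂ} (hσ : σ.IsHermitian) (hρ : ρ.IsHermitian)
    (h : supp ρ ≤ supp σ) (t : ℝ) : mlog (mix σ ρ t + kerProj σ) = mlog (mix σ ρ t) := by
  refine cfc_add_orthogonal_projection (isHermitian_mix hσ hρ t) (isHermitian_kerProj σ)
    (kerProj_mul_self σ) ?_ Real.log_zero Real.log_one
  rw [mix, Matrix.add_mul, Matrix.smul_mul, Matrix.smul_mul, mul_kerProj hσ,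
    mul_kerProj_of_supp_le hρ hσ h, smul_zero, smul_zero, add_zero]

/-- The logarithm is discontinuous at singular operators, but the kernel projection of σ is
orthogonal to ρ as well. Adding it to every mixture changes no logarithm and makes the limit
invertible. -/
theorem tendsto_mlog_mix {σ ρ : Matrix n n ℂ} (hσ : σ.PosSemidef) (hρ : ρ.PosSemidef)
    (h : supp ρ ≤ supp σ) :
    Tendsto (fun t => mlog (mix σ ρ t)) (𝓝[>] 0) (𝓝 (mlog σ)) := by
  have h1 := tendsto_mlog (tendsto_mix (σ + kerProj σ) (ρ + kerProj σ))
    (isHermitian_mix (posDef_add_kerProj hσ).1 (hρ.1.add (isHermitian_kerProj σ)))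
    (posDef_add_kerProj hσ)
  have h2 : mlog (σ + kerProj σ) = mlog σ := by
    have := mlog_mix_add_kerProj hσ.1 hρ.1 h 0
    simpa [mix] using this
  simpa only [← mix_add_kerProj, mlog_mix_add_kerProj hσ.1 hρ.1 h, h2] using h1

/-- The relative entropy of `σ` to `(1 - t) σ + t ρ` is `o(t)`. -/
theorem exists_umegaki_mix_le {σ ρ : Matrix n n ℂ} (hσ : IsDensity σ) (hρ : IsDensity ρ)
    (h : supp ρ ≤ supp σ) : ∃ g : ℝ → ℝ, Tendsto g (𝓝[>] 0) (𝓝 0) ∧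
      ∀ t, 0 ≤ t → t < 1 → umegaki σ (mix σ ρ t) ≤ t * g t := by
  set P := kerProj σ
  have hσP : σ * P = 0 := mul_kerProj hσ.1.1
  have hρP : ρ * P = 0 := mul_kerProj_of_supp_le hρ.1.1 hσ.1.1 h
  have hσ' : (σ + P).PosDef := posDef_add_kerProj hσ.1
  let R : ℝ → Matrix n n ℂ := fun t => cfc (fun s : ℝ => s⁻¹) (mix σ ρ t + P)
  let R₀ : Matrix n n ℂ := cfc (fun s : ℝ => s⁻¹) (σ + P)
  have hR : Tendsto R (𝓝[>] 0) (𝓝 R₀) :=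
    tendsto_cfc_of_posDef ((tendsto_mix σ ρ).add_const P)
      (fun t => (isHermitian_mix hσ.1.1 hρ.1.1 t).add (isHermitian_kerProj σ)) hσ'
      (continuousOn_id.inv₀ fun _ ht => ne_of_gt ht)
  -- Since σ² = σ(mix + P) + tσ(σ - ρ), the quadratic bound for D(σ‖mix) is exactly t Tr σ(σ -
  -- ρ)R_t.
  refine ⟨fun t => (σ * (σ - ρ) * R t).trace.re, ?_, fun t h0 h1 => ?_⟩
  · have hlim := tendsto_trace_re (hR.const_mul (σ * (σ - ρ)))
    have hR₀ : R₀ * σ = 1 - P := by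
      have e1 : R₀ * (σ + P) = 1 := mul_eq_one_comm.1 (mul_cfc_inv hσ')
      have e2 : (σ + P) * (1 - P) = σ := by
        rw [Matrix.mul_sub, Matrix.mul_one, Matrix.add_mul, hσP, kerProj_mul_self, zero_add,
          add_sub_cancel_right]
      calc R₀ * σ = R₀ * (σ + P) * (1 - P) := by rw [Matrix.mul_assoc, e2]
        _ = 1 - P := by rw [e1, Matrix.one_mul]
    -- Cyclicity and R₀σ = 1 - P reduce the limit to Tr(σ - ρ), which vanishes for unit traces.
    have h0 : (σ * (σ - ρ) * R₀).trace.re = 0 := by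
      rw [Matrix.trace_mul_comm, ← Matrix.mul_assoc, hR₀, Matrix.trace_mul_comm, Matrix.mul_sub,
        Matrix.sub_mul _ _ P, hσP, hρP]
      simp [hσ.2, hρ.2]
    rwa [h0] at hlim
  · have hpos : (mix σ ρ t + P).PosDef := by
      rw [mix_add_kerProj]
      exact posDef_mix hσ' (hρ.1.add (posSemidef_kerProj σ)) h0 h1
    have key := umegaki_le_trace hσ.1 hpos
    have e1 : umegaki σ (mix σ ρ t + P) = umegaki σ (mix σ ρ t) := by
      rw [umegaki, umegaki, mlog_mix_add_kerProj hσ.1.1 hρ.1.1 h]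
    have e2 : σ * σ = σ * (mix σ ρ t + P) + t • (σ * (σ - ρ)) := by
      rw [Matrix.mul_add, hσP, mix, Matrix.mul_add, Matrix.mul_smul, Matrix.mul_smul,
        Matrix.mul_sub, smul_sub, sub_smul, one_smul]
      abel
    have e3 : σ * σ * R t = σ + t • (σ * (σ - ρ) * R t) := by
      rw [e2, Matrix.add_mul, Matrix.mul_assoc, mul_cfc_inv hpos, Matrix.mul_one, Matrix.smul_mul]
    rw [e1, e3, Matrix.trace_add, Complex.add_re, add_sub_cancel_left, Matrix.trace_smul,
      Complex.smul_re, smul_eq_mul] at key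
    exact key

end Mixture

/-! ### From concavity back to the partial trace -/

theorem sum_ulift_bool {M : Type*} [AddCommMonoid M] (f : ULift.{u} Bool → M) :
    ∑ i, f i = f ⟨true⟩ + f ⟨false⟩ := by
  rw [← Equiv.ulift.symm.sum_comp, Fintype.sum_bool]
  rfl

theorem ConcavityCondEntropy.buresSq_add_le_mix (h : ConcavityCondEntropy.{u}) {A B : Type u}
    [Fintype A] [DecidableEq A] [Fintype B] [DecidableEq B] {ρ σ : Matrix (A × B) (A × B) ℂ}
    (hρ : IsDensity ρ) (hσ : IsDensity σ) {t : ℝ} (h0 : 0 ≤ t) (h1 : t ≤ 1)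
    (hpos : (trLeft (mix σ ρ t)).PosDef) :
    t * buresSq ρ (petzPartialTrace (mix σ ρ t) (trLeft ρ)) +
        (1 - t) * buresSq σ (petzPartialTrace (mix σ ρ t) (trLeft σ)) ≤
      t * (umegaki ρ (mix σ ρ t) - umegaki (trLeft ρ) (trLeft (mix σ ρ t))) +
        (1 - t) * (umegaki σ (mix σ ρ t) - umegaki (trLeft σ) (trLeft (mix σ ρ t))) := by
  let p : ULift.{u} Bool → ℝ := fun i => if i.down then t else 1 - t
  let ν : ULift.{u} Bool → Matrix (A × B) (A × B) ℂ := fun i => if i.down then ρ else σ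
  have hp : IsProb p := by
    refine ⟨fun i => ?_, by rw [sum_ulift_bool]; simp [p]⟩
    rcases i with ⟨_ | _⟩ <;> simp [p, h0, h1]
  have hν : ∀ i, IsDensity (ν i) := by
    rintro ⟨_ | _⟩
    · exact hσ
    · exact hρ
  have hmix : ∑ i, p i • ν i = mix σ ρ t := by
    rw [sum_ulift_bool]
    simp [p, ν, mix, add_comm]
  have key := h (ULift.{u} Bool) A B p ν hp hν (by rw [hmix]; exact hpos)
  rw [condEntropy_sub_sum_condEntropy hp hν, hmix, EReal.coe_le_coe_iff, sum_ulift_bool,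
    sum_ulift_bool] at key
  exact key

/-- This is a derivative at t = 0 of the two-point concavity inequality: the ρ terms carry the
factor t, and the σ terms that are kept are o(t). -/
theorem ConcavityCondEntropy.monotonicityPartialTrace (h : ConcavityCondEntropy.{u}) :
    MonotonicityPartialTrace.{u} := by
  intro A B _ _ _ _ ρ σ hρ hσ hsupp hpos
  rw [relEntropy_eq hsupp, relEntropy_eq (supp_le_supp_of_posDef _ hpos), ← EReal.coe_sub,
    EReal.coe_le_coe_iff]
  obtain ⟨g, hg, hgle⟩ := exists_umegaki_mix_le hσ hρ hsupp
  have htr (t : ℝ) : trLeft (mix σ ρ t) = mix (trLeft σ) (trLeft ρ) t := by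
    rw [mix, trLeft_add, trLeft_smul, trLeft_smul, mix]
  have hρB := isDensity_trLeft hρ
  have hσB := isDensity_trLeft hσ
  have hherm := isHermitian_mix hσ.1.1 hρ.1.1
  have hlhs : Tendsto (fun t => buresSq ρ (petzPartialTrace (mix σ ρ t) (trLeft ρ))) (𝓝[>] 0)
      (𝓝 (buresSq ρ (petzPartialTrace σ (trLeft ρ)))) :=
    tendsto_buresSq ρ (tendsto_petzPartialTrace (tendsto_mix σ ρ) hherm hσ.1.1 hpos _)
      (fun t => isHermitian_petzPartialTrace _ hρB.1.1) (isHermitian_petzPartialTrace _ hρB.1.1)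
  have hU := tendsto_umegaki_right ρ (tendsto_mlog_mix hσ.1 hρ.1 hsupp)
  have hUB := tendsto_umegaki_right (trLeft ρ)
    (tendsto_mlog_mix hσB.1 hρB.1 (supp_le_supp_of_posDef _ hpos))
  have hrhs : Tendsto (fun t => umegaki ρ (mix σ ρ t) -
      umegaki (trLeft ρ) (mix (trLeft σ) (trLeft ρ) t) + (1 - t) * g t) (𝓝[>] 0)
      (𝓝 (umegaki ρ σ - umegaki (trLeft ρ) (trLeft σ))) := by
    have ht : Tendsto (fun t : ℝ => 1 - t) (𝓝[>] 0) (𝓝 (1 - 0)) :=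
      ((continuous_const.sub continuous_id).tendsto 0).mono_left nhdsWithin_le_nhds
    simpa using (hU.sub hUB).add (ht.mul hg)
  refine le_of_tendsto_of_tendsto hlhs hrhs ?_
  filter_upwards [Ioo_mem_nhdsGT (zero_lt_one' ℝ)] with t ht
  have hmB : (trLeft (mix σ ρ t)).PosDef := by
    rw [htr]
    exact posDef_mix hpos hρB.1 ht.1.le ht.2
  have hmix : IsDensity (mix σ ρ t) := by
    refine ⟨(posSemidef_real_smul hσ.1 (sub_pos.2 ht.2).le).add
      (posSemidef_real_smul hρ.1 ht.1.le), ?_⟩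
    rw [mix, Matrix.trace_add, Matrix.trace_smul, Matrix.trace_smul, hσ.2, hρ.2, ← add_smul]
    simp
  have key := h.buresSq_add_le_mix hρ hσ ht.1.le ht.2.le hmB
  have k1 := buresSq_nonneg hσ (isDensity_petzPartialTrace hmix.1 hmB hσB)
  have k2 := trace_sub_trace_le_umegaki hσB.1 hmB
  -- Both traces are one, so Klein's inequality gives D(σ_B‖mix_B) ≥ 0.
  rw [hσB.2, (isDensity_trLeft hmix).2, sub_self] at k2
  have k3 := hgle t ht.1.le ht.2
  have h1t : 0 < 1 - t := sub_pos.2 ht.2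
  rw [← htr]
  -- Division by t is legitimate as t > 0.
  refine le_of_mul_le_mul_left ?_ ht.1
  have k4 : 0 ≤ (1 - t) * buresSq σ (petzPartialTrace (mix σ ρ t) (trLeft σ)) :=
    mul_nonneg h1t.le k1
  have k5 : (1 - t) * (umegaki σ (mix σ ρ t) - umegaki (trLeft σ) (trLeft (mix σ ρ t))) ≤
      (1 - t) * (t * g t) := mul_le_mul_of_nonneg_left (by linarith) h1t.le
  linarith

end

end PetzRemainder

theorem mainTheorem3 :
    List.TFAE [
      PetzRemainder.StrongSubadditivity.{u},
      PetzRemainder.ConcavityCondEntropy.{u},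
      PetzRemainder.MonotonicityPartialTrace.{u},
      PetzRemainder.JointConvexity.{u},
      PetzRemainder.MonotonicityChannel.{u}] := by
  tfae_have 1 → 2 := fun h => h.concavityCondEntropy
  tfae_have 2 → 3 := fun h => h.monotonicityPartialTrace
  tfae_have 3 → 1 := fun h => h.strongSubadditivity
  tfae_have 3 → 4 := fun h => h.jointConvexity
  tfae_have 4 → 3 := fun h => h.monotonicityPartialTrace
  tfae_have 3 → 5 := fun h => h.monotonicityChannel
  tfae_have 5 → 3 := fun h => h.monotonicityPartialTrace
  tfae_finish
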